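/- Let $p,q\ge 0$ be integers with $p+q\le 9$ and $p-q\not\equiv 1 \pmod 4$, so that the universal real Clifford algebra $\mathcal{C}\ell_{p,q}$, with generators $e_1,\dots,e_{p+q}$, $e_i^2=\varepsilon_i$ ($\varepsilon_i=1$ for $i\le p$, $\varepsilon_i=-1$ for $i>p$), is simple. Let $T_\varepsilon$ be the $\mathbb{R}$-linear anti-automorphism of $\mathcal{C}\ell_{p,q}$ with $T_\varepsilon(e_i)=\varepsilon_i e_i=e_i^{-1}$. By a basis monomial we mean an ordered product $e_I=e_{i_1}\cdots e_{i_s}$, $I=\{i_1<\dots<i_s\}$. Let $k=q-r_{q-p}$, where $r_i$ are the Radon--Hurwitz numbers ($r_0,\dots,r_7=0,1,2,2,3,3,3,3$ and $r_{i+8}=r_i+4$ for $i\in\mathbb{Z}$), and let $N=2^k$. Let $$f=\tfrac12(1\pm e_{I_1})\cdots\tfrac12(1\pm e_{I_k})$$ with any choice of signs, where $e_{I_1},\dots,e_{I_k}$ are pairwise commuting basis monomials with square $1$ that generate a group of order $2^k$ not containing $-1$. Put $\mathbb{K}=f\,\mathcal{C}\ell_{p,q}\,f$, a ring with unit $f$.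 Let $m_1=1,m_2,\dots,m_N$ be basis monomials such that $\mathcal{S}_1=[m_1f,\dots,m_Nf]$ is an ordered basis of $S_1=\mathcal{C}\ell_{p,q}f$ as a right $\mathbb{K}$-module, and put $f_i=m_ifm_i^{-1}$ (so $f_1=f$) and $S_i=\mathcal{C}\ell_{p,q}f_i$. For $u\in\mathcal{C}\ell_{p,q}$ let $[u]=([u]_{ij})\in\mathrm{Mat}(N,\mathbb{K})$ be the matrix of $\phi\mapsto u\phi$ on $S_1$ in the basis $\mathcal{S}_1$, that is, $u\,m_jf=\sum_i m_if\,[u]_{ij}$. Then for every $l\in\{1,\dots,N\}$ and every spinor $\psi_l\in S_l$: * if $p-q\equiv 0,1,2 \pmod 8$, then $\mathbb{K}\cong\mathbb{R}$ and $[T_\varepsilon(\psi_l)]=[\psi_l]^T$; * if $p-q\equiv 3,7 \pmod 8$, then $\mathbb{K}\cong\mathbb{C}$ and $[T_\varepsilon(\psi_l)]=[\psi_l]^\dagger$, the Hermitian complex conjugate; * if $p-q\equiv 4,5,6 \pmod 8$, then $\mathbb{K}\cong\mathbb{H}$ and $[T_\varepsilon(\psi_l)]=[\psi_l]^\ddagger$,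 the Hermitian quaternionic conjugate. Here the isomorphisms are of real algebras, and the conjugation on $\mathbb{K}$ is the one that corresponds to complex, respectively quaternionic, conjugation under any such isomorphism. -/

import Mathlib

open scoped Matrix Quaternion

/-- The signs `ε_i` of the signature `(p, q)`: `p` times `1`, then `q` times `-1`. -/
def sigWeight (p q : ℕ) (i : Fin (p + q)) : ℝ := if (i : ℕ) < p then 1 else -1

lemma sigWeight_mul_self (p q : ℕ) (i : Fin (p + q)) :
    sigWeight p q i * sigWeight p q i = 1 := by
  unfold sigWeight; split <;> norm_num

/-- The standard quadratic form of signature `(p, q)` on `ℝ^(p+q)`. -/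
noncomputable def sigForm (p q : ℕ) : QuadraticForm ℝ (Fin (p + q) → ℝ) :=
  QuadraticMap.weightedSumSquares ℝ (sigWeight p q)

/-- The universal real Clifford algebra of signature `(p, q)`. -/
abbrev Cl (p q : ℕ) : Type := CliffordAlgebra (sigForm p q)

/-- The standard generator `e_i`. -/
noncomputable def clGen (p q : ℕ) (i : Fin (p + q)) : Cl p q :=
  CliffordAlgebra.ι (sigForm p q) (Pi.single i 1)

lemma sigForm_single (p q : ℕ) (i : Fin (p + q)) :
    sigForm p q (Pi.single i 1) = sigWeight p q i := by
  simp [sigForm, QuadraticMap.weightedSumSquares_apply, Pi.single_apply]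

lemma clGen_mul_self (p q : ℕ) (i : Fin (p + q)) :
    clGen p q i * clGen p q i = algebraMap ℝ (Cl p q) (sigWeight p q i) := by
  rw [clGen, CliffordAlgebra.ι_sq_scalar, sigForm_single]

/-- The generator `e_i` as a unit; its inverse is `ε_i e_i`. -/
noncomputable def clGenUnit (p q : ℕ) (i : Fin (p + q)) : (Cl p q)ˣ where
  val := clGen p q i
  inv := sigWeight p q i • clGen p q i
  val_inv := by
    rw [mul_smul_comm, clGen_mul_self, Algebra.smul_def, ← map_mul, sigWeight_mul_self, map_one]
  inv_val := by
    rw [smul_mul_assoc, clGen_mul_self, Algebra.smul_def, ← map_mul, sigWeight_mul_self, map_one]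

/-- The basis monomial `e_I = e_{i_1} ⋯ e_{i_s}`, `I = {i_1 < ⋯ < i_s}`, as a unit of the Clifford
algebra. -/
noncomputable def clMonomial (p q : ℕ) (I : Finset (Fin (p + q))) : (Cl p q)ˣ :=
  ((I.sort (· ≤ ·)).map (clGenUnit p q)).prod

/-- The isometry `t_ε` of `ℝ^{p,q}` with `e_i ↦ ε_i e_i`. -/
noncomputable def tEps (p q : ℕ) : sigForm p q →qᵢ sigForm p q where
  toFun v := fun i => sigWeight p q i * v i
  map_add' v w := by ext i; simp [mul_add]
  map_smul' c v := by ext i; simp [mul_left_comm]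
  map_app' v := by
    simp only [sigForm, QuadraticMap.weightedSumSquares_apply, smul_eq_mul]
    refine Finset.sum_congr rfl fun i _ => ?_
    linear_combination (sigWeight p q i * v i * v i) * sigWeight_mul_self p q i

/-- The transposition anti-involution `T_ε` of `Cl_{p,q}`: the anti-automorphism that extends
`t_ε`, i.e. the composite of the automorphism induced by `t_ε` and the reversion. -/
noncomputable def TEps (p q : ℕ) : Cl p q →ₗ[ℝ] Cl p q :=
  CliffordAlgebra.reverse ∘ₗ (CliffordAlgebra.map (tEps p q)).toLinearMap

lemma TEps_mul (p q : ℕ) (x y : Cl p q) : TEps p q (x * y) = TEps p q y * TEps p q x := by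
  simp [TEps]

lemma TEps_one (p q : ℕ) : TEps p q 1 = 1 := by
  simp [TEps]

lemma TEps_clGen (p q : ℕ) (i : Fin (p + q)) :
    TEps p q (clGen p q i) = sigWeight p q i • clGen p q i := by
  have h : tEps p q (Pi.single i 1) = sigWeight p q i • (Pi.single i 1 : Fin (p + q) → ℝ) := by
    ext j
    change sigWeight p q j * (Pi.single i 1 : Fin (p + q) → ℝ) j = _
    by_cases hj : j = i
    · subst hj; simp
    · simp [hj]
  simp [TEps, clGen, h]

/-- The Radon–Hurwitz numbers: `r_0, …, r_7 = 0, 1, 2, 2, 3, 3, 3, 3` and `r_{i+8} = r_i + 4`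
for all integers `i`. -/
def radonHurwitz (i : ℤ) : ℤ :=
  4 * (i / 8) +
    (if i % 8 = 0 then 0 else if i % 8 = 1 then 1 else if i % 8 = 2 ∨ i % 8 = 3 then 2 else 3)

/-- The data of an idempotent `½(1 ± e_{T_1}) ⋯ ½(1 ± e_{T_k})`: pairwise commuting basis monomials
with square `1` that generate a group of order `2^k` not containing `-1`, and a choice of signs. -/
structure IdempotentFactors (p q k : ℕ) where
  /-- the index sets of the monomials -/
  idx : Fin k → Finset (Fin (p + q))
  /-- the signs -/
  sgn : Fin k → ℤˣ
  sq_eq_one : ∀ i, clMonomial p q (idx i) * clMonomial p q (idx i) = 1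
  comm : ∀ i j, Commute (clMonomial p q (idx i)) (clMonomial p q (idx j))
  card_group : Nat.card (Subgroup.closure (Set.range fun i => clMonomial p q (idx i))) = 2 ^ k
  neg_one_notMem : (-1 : (Cl p q)ˣ) ∉ Subgroup.closure (Set.range fun i => clMonomial p q (idx i))

lemma isIdempotentElem_list_prod {A : Type*} [Monoid A] (l : List A)
    (hi : ∀ x ∈ l, IsIdempotentElem x) (hc : ∀ x ∈ l, ∀ y ∈ l, Commute x y) :
    IsIdempotentElem l.prod := by
  induction l with
  | nil => simp [IsIdempotentElem]
  | cons a l ih =>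
    rw [List.prod_cons]
    refine IsIdempotentElem.mul_of_commute ?_ (hi a (by simp)) (ih ?_ ?_)
    · exact Commute.list_prod_right _ _ fun y hy => hc a (by simp) y (by simp [hy])
    · exact fun x hx => hi x (by simp [hx])
    · exact fun x hx y hy => hc x (by simp [hx]) y (by simp [hy])

/-- The division ring `K = f A f` is an algebra over the ground field of `A`, with unit `f`. -/
noncomputable instance cornerAlgebra {A : Type*} [Ring A] [Algebra ℝ A] {f : A}
    (hf : IsIdempotentElem f) : Algebra ℝ hf.Corner where
  smul c x := ⟨c • x.1, by
    obtain ⟨a, ha⟩ := x.2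
    exact ⟨c • a, by simpa using congrArg (c • ·) ha⟩⟩
  algebraMap :=
    { toFun := fun c => ⟨c • f, ⟨c • 1, by simp [hf.eq]⟩⟩
      map_one' := Subtype.ext (one_smul ℝ f)
      map_zero' := Subtype.ext (zero_smul ℝ f)
      map_add' := fun c d => Subtype.ext (add_smul c d f)
      map_mul' := fun c d => Subtype.ext (by
        change (c * d) • f = (c • f) * (d • f)
        rw [smul_mul_smul_comm, hf.eq]) }
  commutes' c x := Subtype.ext (by
    have h := (Subsemigroup.mem_corner_iff hf).1 x.2
    change (c • f) * x.1 = x.1 * (c • f)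
    rw [smul_mul_assoc, mul_smul_comm, h.1, h.2])
  smul_def' c x := Subtype.ext (by
    have h := (Subsemigroup.mem_corner_iff hf).1 x.2
    change c • x.1 = (c • f) * x.1
    rw [smul_mul_assoc, h.1])

/-- The left ideal `A f` is a right `f A f`-module by `ψ · λ = ψ λ`. -/
noncomputable instance leftIdealModule {A : Type*} [Ring A] {f : A}
    (hf : IsIdempotentElem f) : Module (hf.Corner)ᵐᵒᵖ (Ideal.span {f} : Ideal A) where
  smul c x := ⟨x.1 * c.unop.1, by
    have h := (Subsemigroup.mem_corner_iff hf).1 c.unop.2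
    refine Ideal.mem_span_singleton'.2 ⟨x.1 * c.unop.1, ?_⟩
    rw [mul_assoc, h.2]⟩
  one_smul x := Subtype.ext (by
    obtain ⟨a, ha⟩ := Ideal.mem_span_singleton'.1 x.2
    change x.1 * f = x.1
    rw [← ha, mul_assoc, hf.eq])
  mul_smul c d x := Subtype.ext (by
    change x.1 * (d.unop.1 * c.unop.1) = (x.1 * d.unop.1) * c.unop.1
    rw [mul_assoc])
  smul_zero c := Subtype.ext (zero_mul c.unop.1)
  smul_add c x y := Subtype.ext (add_mul x.1 y.1 c.unop.1)
  add_smul c d x := Subtype.ext (mul_add x.1 c.unop.1 d.unop.1)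
  zero_smul x := Subtype.ext (mul_zero x.1)

namespace IdempotentFactors

variable {p q k : ℕ} (F : IdempotentFactors p q k)

/-- The idempotent `f = ½(1 ± e_{T_1}) ⋯ ½(1 ± e_{T_k})`. -/
noncomputable def f : Cl p q :=
  (List.ofFn fun i => (1 / 2 : ℝ) •
    ((1 : Cl p q) + ((F.sgn i : ℤ) : ℝ) • (clMonomial p q (F.idx i) : Cl p q))).prod

lemma isIdempotentElem_f : IsIdempotentElem F.f := by
  refine isIdempotentElem_list_prod _ ?_ ?_
  · intro x hx
    obtain ⟨i, rfl⟩ := (List.mem_ofFn' _ _).1 hx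
    have h : (clMonomial p q (F.idx i) : Cl p q) * clMonomial p q (F.idx i) = 1 := by
      rw [← Units.val_mul, F.sq_eq_one, Units.val_one]
    have hs : (((F.sgn i : ℤ) : ℝ)) * ((F.sgn i : ℤ) : ℝ) = 1 := by
      rcases Int.units_eq_one_or (F.sgn i) with h | h <;> simp [h]
    unfold IsIdempotentElem
    simp only [smul_mul_smul_comm, mul_add, add_mul, one_mul, mul_one, h, hs]
    module
  · intro x hx y hy
    obtain ⟨i, rfl⟩ := (List.mem_ofFn' _ _).1 hx
    obtain ⟨j, rfl⟩ := (List.mem_ofFn' _ _).1 hy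
    have h : Commute (clMonomial p q (F.idx i) : Cl p q) (clMonomial p q (F.idx j)) :=
      (F.comm i j).units_val
    refine Commute.smul_left (Commute.smul_right ?_ _) _
    exact (Commute.one_left _).add_left
      (((Commute.one_right _).add_right (h.smul_right _)).smul_left _)

/-- The ring `K = f Cl_{p,q} f`, with unit `f`. -/
abbrev K : Type := F.isIdempotentElem_f.Corner

/-- The left ideal `S = Cl_{p,q} f`, a right `K`-module. -/
noncomputable abbrev S : Ideal (Cl p q) := Ideal.span {F.f}

/-- The conjugate idempotent `m f m⁻¹` for the basis monomial `m = e_I`. -/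
noncomputable def conj (I : Finset (Fin (p + q))) : Cl p q :=
  (clMonomial p q I : Cl p q) * F.f * ((clMonomial p q I)⁻¹ : (Cl p q)ˣ)

/-- The matrix `[u]` in the spinor representation `u ↦ (φ ↦ u φ)` on `S` relative to an ordered
basis `b` of the right `K`-vector space `S`, that is `u b_j = ∑ i, b_i [u]_{ij}`. -/
noncomputable def spinorMatrix {N : ℕ} (b : Module.Basis (Fin N) (F.K)ᵐᵒᵖ F.S) (u : Cl p q) :
    Matrix (Fin N) (Fin N) F.K :=
  Matrix.of fun i j => (b.repr (u • b j) i).unop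

end IdempotentFactors

/-! ### The group of signed basis monomials. -/

section MonomialGroup

variable {p q : ℕ}

/-! Put n = p + q. The signed basis monomials form a finite group G of order 2^(n+1). Its elements
square to ±1 and pairwise commute or anticommute, and it spans the algebra. Let E be the group
generated by -1 and the monomials of f, and let H be the subgroup of G commuting with those
monomials. For u in G, f u f is u f if u lies in H and 0 otherwise, since an anticommuting factor of
f gives f u f = -f u f (`f_mul_mul_f_of_notMem`). So the images of H span K, and E acts on f by ±1.

The elements f m_i⁻¹ are dual to the basis m_i f, so [u]_{ij} = f m_i⁻¹ u m_j f. As T_ε inverts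
every signed monomial, it turns m_i⁻¹ u m_j into m_j⁻¹ T_ε(u) m_i. It remains to see that T_ε
becomes conjugation on K (`spinorMatrix_TEps`). The image z of a monomial of H satisfies z² = ±1,
and inverting the monomial gives ±z. In ℝ, ℂ and ℍ conjugation does the same: a root of 1 is fixed,
a root of -1 changes sign. The argument works for every element of the algebra, not only for
spinors.

To identify K, note that the m_i represent the cosets of H in G, so |H| = 2^(n+1-k), while |E| =
2^(k+1) (`card_commutantFinset`, `card_signedFactorFinset`). The sum of the square signs over G is 2
Re((1-i)(1+i)^p(1-i)^q); elements outside H cancel in pairs, so H has the same sum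
(`sum_squareInt_commutant`). In the complex and quaternionic cases this is the least value possible
given that E squares to 1, so everything in H outside E squares to -1. The index |H : E| = 1, 2 or 4
then yields ℝ, ℂ or ℍ. That f ≠ 0 follows from independence of the monomials: its coefficient at 1
is 2^(-k). -/

lemma clGen_mul_clGen_of_ne {i j : Fin (p + q)} (h : i ≠ j) :
    clGen p q i * clGen p q j = -(clGen p q j * clGen p q i) := by
  refine CliffordAlgebra.ι_mul_ι_comm_of_isOrtho ?_
  rw [QuadraticMap.isOrtho_def]
  simp only [sigForm, QuadraticMap.weightedSumSquares_apply, ← Finset.sum_add_distrib]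
  refine Finset.sum_congr rfl fun l _ => ?_
  by_cases hi : l = i
  · subst hi; simp [h]
  · simp [hi]

lemma clGenUnit_mul_clGenUnit_of_ne {i j : Fin (p + q)} (h : i ≠ j) :
    clGenUnit p q i * clGenUnit p q j = -(clGenUnit p q j * clGenUnit p q i) :=
  Units.ext (by simpa [clGenUnit] using clGen_mul_clGen_of_ne h)

/-- The sign `ε_i` as an integer unit. -/
def sigSign (p q : ℕ) (i : Fin (p + q)) : ℤˣ := if (i : ℕ) < p then 1 else -1

/-- The action of a sign on the units of a ring. -/
def signUnit (A : Type*) [Ring A] : ℤˣ →* Aˣ := Units.map (Int.castRingHom A).toMonoidHom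

@[simp] lemma signUnit_neg_one (A : Type*) [Ring A] : signUnit A (-1) = -1 := by
  ext; simp [signUnit]

lemma signUnit_mul_comm {A : Type*} [Ring A] (s : ℤˣ) (u : Aˣ) :
    u * signUnit A s = signUnit A s * u := by
  rcases Int.units_eq_one_or s with rfl | rfl <;> simp

lemma signUnit_eq {A : Type*} [Ring A] (s : ℤˣ) : signUnit A s = 1 ∨ signUnit A s = -1 := by
  rcases Int.units_eq_one_or s with rfl | rfl <;> simp

lemma clGenUnit_sq (i : Fin (p + q)) :
    clGenUnit p q i * clGenUnit p q i = signUnit _ (sigSign p q i) := by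
  ext
  simp only [clGenUnit, Units.val_mul, clGen_mul_self, sigWeight, sigSign]
  split <;> simp

/-- The product of the generators along a list of indices. -/
noncomputable def clProd (p q : ℕ) (l : List (Fin (p + q))) : (Cl p q)ˣ :=
  (l.map (clGenUnit p q)).prod

@[simp] lemma clProd_nil : clProd p q [] = 1 := rfl

@[simp] lemma clProd_cons (i : Fin (p + q)) (l : List (Fin (p + q))) :
    clProd p q (i :: l) = clGenUnit p q i * clProd p q l := rfl

lemma clMonomial_eq_clProd (I : Finset (Fin (p + q))) :
    clMonomial p q I = clProd p q (I.sort (· ≤ ·)) := rfl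

lemma clMonomial_empty : clMonomial p q ∅ = 1 := by simp [clMonomial]

lemma clProd_mul_clGenUnit {i : Fin (p + q)} {l : List (Fin (p + q))} (h : i ∉ l) :
    clProd p q l * clGenUnit p q i =
      signUnit _ ((-1) ^ l.length) * (clGenUnit p q i * clProd p q l) := by
  induction l with
  | nil => simp
  | cons a l ih =>
    rw [List.mem_cons, not_or] at h
    rw [clProd_cons, mul_assoc, ih h.2, ← mul_assoc, signUnit_mul_comm, mul_assoc, ← mul_assoc _ _ (clProd p q l),
      clGenUnit_mul_clGenUnit_of_ne (Ne.symm h.1), List.length_cons, pow_succ, map_mul]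
    simp [mul_assoc]

/-- The sign of the square of a product of distinct generators. -/
def squareSign (p q : ℕ) (I : Finset (Fin (p + q))) : ℤˣ :=
  (-1) ^ (I.card.choose 2) * ∏ i ∈ I, sigSign p q i

/-- Moving the first generator past the remaining s ones costs (-1)^s, and C(s+1, 2) = s + C(s, 2).
-/
lemma clProd_mul_self {l : List (Fin (p + q))} (h : l.Nodup) :
    clProd p q l * clProd p q l =
      signUnit _ ((-1) ^ (l.length.choose 2) * (l.map (sigSign p q)).prod) := by
  induction l with
  | nil => simp
  | cons a l ih =>
    rw [List.nodup_cons] at h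
    have e : clProd p q (a :: l) * clProd p q (a :: l) =
        clGenUnit p q a * (clProd p q l * clGenUnit p q a) * clProd p q l := by
      simp [mul_assoc]
    have e2 : clGenUnit p q a * (signUnit (Cl p q) ((-1) ^ l.length) *
        (clGenUnit p q a * clProd p q l)) * clProd p q l =
        signUnit _ ((-1) ^ l.length) * (clGenUnit p q a * clGenUnit p q a) *
          (clProd p q l * clProd p q l) := by
      rw [← mul_assoc (clGenUnit p q a), signUnit_mul_comm]
      simp [mul_assoc]
    rw [e, clProd_mul_clGenUnit h.1, e2, clGenUnit_sq, ih h.2, ← map_mul, ← map_mul,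
      List.length_cons, Nat.choose_succ_succ' l.length 1, Nat.choose_one_right, pow_add]
    congr 1
    simp only [List.map_cons, List.prod_cons]
    simp only [mul_assoc, mul_left_comm]

lemma clMonomial_mul_self (I : Finset (Fin (p + q))) :
    clMonomial p q I * clMonomial p q I = signUnit _ (squareSign p q I) := by
  rw [clMonomial_eq_clProd, clProd_mul_self (Finset.sort_nodup _ _), squareSign,
    Finset.length_sort]
  congr 2
  rw [← List.prod_toFinset _ (Finset.sort_nodup _ _), Finset.sort_toFinset]

lemma clProd_perm {l l' : List (Fin (p + q))} (h : l.Perm l') :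
    clProd p q l = clProd p q l' ∨ clProd p q l = -clProd p q l' := by
  induction h with
  | nil => simp
  | cons x _ ih => rcases ih with h | h <;> simp [h]
  | swap x y l =>
    by_cases hxy : x = y
    · subst hxy; simp
    · right
      rw [clProd_cons, clProd_cons, clProd_cons, clProd_cons, ← mul_assoc,
        clGenUnit_mul_clGenUnit_of_ne (Ne.symm hxy), neg_mul, mul_assoc]
  | trans _ _ h1 h2 => rcases h1 with h | h <;> rcases h2 with h' | h' <;> simp [h, h']

lemma clProd_eq_clMonomial {l : List (Fin (p + q))} (h : l.Nodup) :
    clProd p q l = clMonomial p q l.toFinset ∨ clProd p q l = -clMonomial p q l.toFinset :=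
  clProd_perm (List.perm_of_nodup_nodup_toFinset_eq h (Finset.sort_nodup _ _)
    (Finset.sort_toFinset _ _).symm)

lemma clGenUnit_mul_clMonomial (i : Fin (p + q)) (I : Finset (Fin (p + q))) :
    ∃ J, clGenUnit p q i * clMonomial p q I = clMonomial p q J ∨
      clGenUnit p q i * clMonomial p q I = -clMonomial p q J := by
  by_cases hi : i ∈ I
  · have hn : (i :: (I.erase i).sort (· ≤ ·)).Nodup := by simp
    have ht : (i :: (I.erase i).sort (· ≤ ·)).toFinset = I := by simp [hi]
    have h := clProd_eq_clMonomial hn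
    rw [ht, clProd_cons, ← clMonomial_eq_clProd] at h
    refine ⟨I.erase i, ?_⟩
    have h2 : clGenUnit p q i * (clGenUnit p q i * clMonomial p q (I.erase i)) =
        signUnit _ (sigSign p q i) * clMonomial p q (I.erase i) := by
      rw [← mul_assoc, clGenUnit_sq]
    rcases h with h | h <;> rw [h] at h2 <;>
      rcases signUnit_eq (A := Cl p q) (sigSign p q i) with hs | hs <;> rw [hs] at h2
    · left; simpa using h2
    · right; simpa using h2
    · right; simpa [neg_eq_iff_eq_neg] using h2
    · left; simpa using h2
  · have h := clProd_eq_clMonomial (p := p) (q := q) (l := i :: I.sort (· ≤ ·)) (by simp [hi])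
    exact ⟨_, h⟩

/-- The predicate of being a basis monomial up to sign. -/
def IsSignedMonomial (u : (Cl p q)ˣ) : Prop :=
  ∃ I, u = clMonomial p q I ∨ u = -clMonomial p q I

lemma IsSignedMonomial.neg {u : (Cl p q)ˣ} (h : IsSignedMonomial u) : IsSignedMonomial (-u) := by
  obtain ⟨I, rfl | rfl⟩ := h
  · exact ⟨I, Or.inr rfl⟩
  · exact ⟨I, Or.inl (neg_neg _)⟩

lemma IsSignedMonomial.clGenUnit_mul {u : (Cl p q)ˣ} (h : IsSignedMonomial u)
    (i : Fin (p + q)) : IsSignedMonomial (clGenUnit p q i * u) := by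
  obtain ⟨I, rfl | rfl⟩ := h
  · exact clGenUnit_mul_clMonomial i I
  · rw [mul_neg]
    exact IsSignedMonomial.neg (clGenUnit_mul_clMonomial i I)

lemma IsSignedMonomial.clProd_mul {u : (Cl p q)ˣ} (h : IsSignedMonomial u)
    (l : List (Fin (p + q))) : IsSignedMonomial (clProd p q l * u) := by
  induction l with
  | nil => simpa
  | cons a l ih => rw [clProd_cons, mul_assoc]; exact ih.clGenUnit_mul a

lemma IsSignedMonomial.mul {u v : (Cl p q)ˣ} (hu : IsSignedMonomial u)
    (hv : IsSignedMonomial v) : IsSignedMonomial (u * v) := by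
  obtain ⟨I, rfl | rfl⟩ := hu
  · exact hv.clProd_mul _
  · rw [neg_mul]; exact (hv.clProd_mul _).neg

lemma IsSignedMonomial.mul_self {u : (Cl p q)ˣ} (hu : IsSignedMonomial u) :
    u * u = 1 ∨ u * u = -1 := by
  obtain ⟨I, rfl | rfl⟩ := hu <;> simpa [clMonomial_mul_self] using signUnit_eq _

variable (p q) in
/-- The group of basis monomials up to sign. -/
def monomialGroup : Subgroup (Cl p q)ˣ where
  carrier := {u | IsSignedMonomial u}
  mul_mem' := IsSignedMonomial.mul
  one_mem' := ⟨∅, Or.inl clMonomial_empty.symm⟩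
  inv_mem' := by
    intro u hu
    rcases hu.mul_self with h | h
    · rwa [inv_eq_of_mul_eq_one_left h]
    · rw [inv_eq_of_mul_eq_one_left (a := -u) (by rw [neg_mul, h, neg_neg])]
      exact hu.neg

lemma mem_monomialGroup {u : (Cl p q)ˣ} :
    u ∈ monomialGroup p q ↔ ∃ I, u = clMonomial p q I ∨ u = -clMonomial p q I := Iff.rfl

lemma clMonomial_mem (I : Finset (Fin (p + q))) : clMonomial p q I ∈ monomialGroup p q :=
  ⟨I, Or.inl rfl⟩

lemma neg_mem_monomialGroup {u : (Cl p q)ˣ} (h : u ∈ monomialGroup p q) :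
    -u ∈ monomialGroup p q := IsSignedMonomial.neg h

lemma monomialGroup_mul_self {u : (Cl p q)ˣ} (h : u ∈ monomialGroup p q) :
    u * u = 1 ∨ u * u = -1 := IsSignedMonomial.mul_self h

lemma monomialGroup_inv {u : (Cl p q)ˣ} (h : u ∈ monomialGroup p q) :
    u⁻¹ = u ∨ u⁻¹ = -u := by
  rcases monomialGroup_mul_self h with h | h
  · exact Or.inl (inv_eq_of_mul_eq_one_left h)
  · exact Or.inr (inv_eq_of_mul_eq_one_left (by rw [neg_mul, h, neg_neg]))

/-- Every inverse here is the element itself up to sign, so (uv)⁻¹ = v⁻¹u⁻¹ reads uv = ±vu. -/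
lemma monomialGroup_mul_comm {u v : (Cl p q)ˣ} (hu : u ∈ monomialGroup p q)
    (hv : v ∈ monomialGroup p q) : u * v = v * u ∨ u * v = -(v * u) := by
  have e : (u * v)⁻¹ = v⁻¹ * u⁻¹ := mul_inv_rev u v
  rcases monomialGroup_inv (mul_mem hu hv) with h1 | h1 <;>
    rcases monomialGroup_inv hu with h2 | h2 <;>
    rcases monomialGroup_inv hv with h3 | h3 <;>
    rw [h1, h2, h3] at e <;> try simp only [neg_mul, mul_neg, neg_neg] at e
  all_goals first
    | exact Or.inl e
    | exact Or.inr e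
    | exact Or.inl (neg_injective e)
    | exact Or.inr (neg_eq_iff_eq_neg.1 e)

lemma clGenUnit_mem (i : Fin (p + q)) : clGenUnit p q i ∈ monomialGroup p q := by
  have := IsSignedMonomial.clGenUnit_mul (one_mem (monomialGroup p q)) i
  rwa [mul_one] at this

/-- The basis monomials up to sign span the Clifford algebra. -/
lemma span_monomialGroup :
    Submodule.span ℝ ((fun u : (Cl p q)ˣ => (u : Cl p q)) '' monomialGroup p q) = ⊤ := by
  set S := Submodule.span ℝ ((fun u : (Cl p q)ˣ => (u : Cl p q)) '' monomialGroup p q) with hS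
  have hmem {u : (Cl p q)ˣ} (h : u ∈ monomialGroup p q) : (u : Cl p q) ∈ S :=
    Submodule.subset_span ⟨u, h, rfl⟩
  have hmul : S * S ≤ S := by
    rw [hS, Submodule.span_mul_span, Submodule.span_le]
    rintro _ ⟨_, ⟨u, hu, rfl⟩, _, ⟨v, hv, rfl⟩, rfl⟩
    exact hmem (mul_mem hu hv)
  refine eq_top_iff.2 fun x _ => ?_
  induction x using CliffordAlgebra.induction with
  | algebraMap r =>
    rw [Algebra.algebraMap_eq_smul_one]
    exact S.smul_mem _ (hmem (one_mem _))
  | ι v =>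
    rw [show v = ∑ i, v i • (Pi.single i 1 : Fin (p + q) → ℝ) from pi_eq_sum_univ' v, map_sum]
    refine S.sum_mem fun i _ => ?_
    rw [map_smul]
    exact S.smul_mem _ (hmem (clGenUnit_mem i))
  | mul a b ha hb => exact hmul (Submodule.mul_mem_mul (ha trivial) (hb trivial))
  | add a b ha hb => exact S.add_mem (ha trivial) (hb trivial)

lemma TEps_clProd (l : List (Fin (p + q))) :
    TEps p q (clProd p q l : Cl p q) = ((clProd p q l)⁻¹ : (Cl p q)ˣ) := by
  induction l with
  | nil => simp [TEps_one]
  | cons a l ih =>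
    rw [clProd_cons, Units.val_mul, TEps_mul, ih, mul_inv_rev, Units.val_mul]
    congr 1
    exact TEps_clGen p q a

/-- An anti-automorphism that inverts each generator inverts their products. This is the only
property of T_ε on which the matrix identity rests. -/
lemma TEps_val {u : (Cl p q)ˣ} (h : u ∈ monomialGroup p q) :
    TEps p q (u : Cl p q) = (u⁻¹ : (Cl p q)ˣ) := by
  obtain ⟨I, rfl | rfl⟩ := h
  · exact TEps_clProd _
  · rw [Units.val_neg, map_neg, inv_neg, Units.val_neg, clMonomial_eq_clProd, TEps_clProd]

lemma TEps_inv {u : (Cl p q)ˣ} (h : u ∈ monomialGroup p q) :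
    TEps p q ((u⁻¹ : (Cl p q)ˣ) : Cl p q) = u := by
  rw [TEps_val (inv_mem h), inv_inv]

end MonomialGroup

/-! ### Independence of the monomials, through an explicit representation. -/

section Representation

variable {p q : ℕ}

/-- The operator by which the generator `e_i` acts on functions on index sets. -/
noncomputable def genOp (p q : ℕ) (i : Fin (p + q)) :
    Module.End ℝ (Finset (Fin (p + q)) → ℝ) where
  -- Left multiplication by e_i in coordinates for the rescaled basis (∏_{j ∈ J} ε_j) e_J. The first
  -- sign comes from moving e_i past the smaller indices.
  toFun φ J := (-1) ^ (J.filter (· < i)).card * (if i ∈ J then sigWeight p q i else 1) *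
    φ (symmDiff J {i})
  map_add' φ χ := by ext J; simp [mul_add]
  map_smul' c φ := by ext J; simp [mul_left_comm]

lemma genOp_apply (i : Fin (p + q)) (φ : Finset (Fin (p + q)) → ℝ) (J : Finset (Fin (p + q))) :
    genOp p q i φ J = (-1) ^ (J.filter (· < i)).card * (if i ∈ J then sigWeight p q i else 1) *
      φ (symmDiff J {i}) := rfl

lemma filter_lt_symmDiff_of_le {n : ℕ} {i j : Fin n} (h : i ≤ j) (J : Finset (Fin n)) :
    (symmDiff J {j}).filter (· < i) = J.filter (· < i) := by
  ext a
  simp only [Finset.mem_filter, Finset.mem_symmDiff, Finset.mem_singleton]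
  grind

lemma neg_one_pow_card_filter_lt_symmDiff {n : ℕ} {i j : Fin n} (h : j < i)
    (J : Finset (Fin n)) :
    (-1 : ℝ) ^ ((symmDiff J {j}).filter (· < i)).card = -(-1) ^ (J.filter (· < i)).card := by
  by_cases hj : j ∈ J
  · have : J.filter (· < i) = insert j ((symmDiff J {j}).filter (· < i)) := by
      ext a
      simp only [Finset.mem_filter, Finset.mem_symmDiff, Finset.mem_singleton, Finset.mem_insert]
      grind
    rw [this, Finset.card_insert_of_notMem (by simp [Finset.mem_symmDiff, hj]), pow_succ]
    ring
  · have : (symmDiff J {j}).filter (· < i) = insert j (J.filter (· < i)) := by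
      ext a
      simp only [Finset.mem_filter, Finset.mem_symmDiff, Finset.mem_singleton, Finset.mem_insert]
      grind
    rw [this, Finset.card_insert_of_notMem (by simp [hj]), pow_succ]
    ring

lemma genOp_mul_self (i : Fin (p + q)) :
    genOp p q i * genOp p q i = sigWeight p q i • (1 : Module.End ℝ _) := by
  refine LinearMap.ext fun φ => funext fun J => ?_
  simp only [Module.End.mul_apply, genOp_apply, filter_lt_symmDiff_of_le le_rfl,
    symmDiff_symmDiff_cancel_right, LinearMap.smul_apply, Module.End.one_apply, Pi.smul_apply,
    smul_eq_mul]
  have h : ((-1 : ℝ) ^ (J.filter (· < i)).card) * (-1) ^ (J.filter (· < i)).card = 1 := by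
    rw [← mul_pow]; simp
  by_cases hi : i ∈ J <;> simp [hi, Finset.mem_symmDiff] <;>
    linear_combination (sigWeight p q i * φ J) * h

lemma genOp_anticomm_of_lt {i j : Fin (p + q)} (h : j < i) :
    genOp p q i * genOp p q j + genOp p q j * genOp p q i = 0 := by
  refine LinearMap.ext fun φ => funext fun J => ?_
  have e : symmDiff (symmDiff J {i}) {j} = symmDiff (symmDiff J {j}) {i} := symmDiff_right_comm _ _ _
  have hi : i ∈ symmDiff J {j} ↔ i ∈ J := by
    simp [Finset.mem_symmDiff, h.ne']
  have hj : j ∈ symmDiff J {i} ↔ j ∈ J := by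
    simp [Finset.mem_symmDiff, h.ne]
  simp only [LinearMap.add_apply, Module.End.mul_apply, genOp_apply, Pi.add_apply,
    filter_lt_symmDiff_of_le h.le, neg_one_pow_card_filter_lt_symmDiff h, e, hi, hj,
    LinearMap.zero_apply, Pi.zero_apply]
  ring

lemma genOp_anticomm {i j : Fin (p + q)} (h : i ≠ j) :
    genOp p q i * genOp p q j + genOp p q j * genOp p q i = 0 := by
  rcases lt_or_gt_of_ne h with h | h
  · exact (add_comm _ _).trans (genOp_anticomm_of_lt h)
  · exact genOp_anticomm_of_lt h

/-- The operator by which a vector acts on functions on index sets. -/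
noncomputable def vecOp (p q : ℕ) :
    (Fin (p + q) → ℝ) →ₗ[ℝ] Module.End ℝ (Finset (Fin (p + q)) → ℝ) :=
  Fintype.linearCombination ℝ (genOp p q)

lemma vecOp_mul_self (v : Fin (p + q) → ℝ) :
    vecOp p q v * vecOp p q v = algebraMap ℝ _ (sigForm p q v) := by
  have h1 : vecOp p q v * vecOp p q v =
      ∑ i, ∑ j, (v i * v j) • (genOp p q i * genOp p q j) := by
    simp only [vecOp, Fintype.linearCombination_apply, Finset.sum_mul_sum, smul_mul_smul_comm]
  have h2 : vecOp p q v * vecOp p q v =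
      ∑ i, ∑ j, (v i * v j) • (genOp p q j * genOp p q i) := by
    rw [h1, Finset.sum_comm]
    simp only [mul_comm]
  -- Adding the double sum to its transpose leaves only the diagonal, as the off-diagonal terms
  -- anticommute; the factor 2 is cancelled at the end.
  have h3 : (2 : ℝ) • (vecOp p q v * vecOp p q v) =
      (2 : ℝ) • algebraMap ℝ _ (sigForm p q v) := by
    rw [two_smul]
    nth_rewrite 1 [h1]
    rw [h2]
    simp only [← Finset.sum_add_distrib, ← smul_add]
    rw [Finset.sum_congr rfl fun i _ => Finset.sum_eq_single i
      (fun j _ hj => by rw [genOp_anticomm (Ne.symm hj), smul_zero]) (by simp)]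
    simp only [genOp_mul_self, sigForm, QuadraticMap.weightedSumSquares_apply, map_sum,
      Finset.smul_sum, Algebra.algebraMap_eq_smul_one]
    refine Finset.sum_congr rfl fun i _ => ?_
    simp only [smul_eq_mul]
    module
  exact smul_right_injective _ (two_ne_zero (α := ℝ)) h3

/-- The representation of the Clifford algebra on functions on index sets. -/
noncomputable def subsetRep (p q : ℕ) :
    Cl p q →ₐ[ℝ] Module.End ℝ (Finset (Fin (p + q)) → ℝ) :=
  CliffordAlgebra.lift (sigForm p q) ⟨vecOp p q, vecOp_mul_self⟩

lemma subsetRep_clGen (i : Fin (p + q)) : subsetRep p q (clGen p q i) = genOp p q i := by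
  simp [subsetRep, clGen, vecOp, Fintype.linearCombination_apply_single]

lemma genOp_single {i : Fin (p + q)} {J : Finset (Fin (p + q))} (h : i ∉ J) :
    ∃ s : ℤˣ, genOp p q i (Pi.single J 1) = ((s : ℤ) : ℝ) • Pi.single (insert i J) 1 := by
  have e : symmDiff (insert i J) {i} = J := by
    ext a; simp only [Finset.mem_symmDiff, Finset.mem_insert, Finset.mem_singleton]; grind
  refine ⟨(-1) ^ ((insert i J).filter (· < i)).card * sigSign p q i, ?_⟩
  ext K
  rw [genOp_apply, Pi.smul_apply, smul_eq_mul]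
  by_cases hK : K = insert i J
  · subst hK
    rw [e]
    simp only [Finset.mem_insert, true_or, if_true, Pi.single_eq_same, sigSign, sigWeight]
    split <;> simp
  · have : symmDiff K {i} ≠ J := by
      rintro rfl
      apply hK
      ext a
      simp only [Finset.mem_symmDiff, Finset.mem_insert, Finset.mem_singleton] at h ⊢
      grind
    simp [hK, this]

lemma subsetRep_clProd {l : List (Fin (p + q))} (h : l.Nodup) :
    ∃ s : ℤˣ, subsetRep p q (clProd p q l : Cl p q) (Pi.single ∅ 1) =
      ((s : ℤ) : ℝ) • Pi.single l.toFinset 1 := by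
  induction l with
  | nil => exact ⟨1, by simp⟩
  | cons a l ih =>
    rw [List.nodup_cons] at h
    obtain ⟨s, hs⟩ := ih h.2
    obtain ⟨t, ht⟩ := genOp_single (p := p) (q := q) (i := a) (J := l.toFinset) (by simpa using h.1)
    refine ⟨s * t, ?_⟩
    rw [clProd_cons, Units.val_mul, map_mul, Module.End.mul_apply, hs, map_smul,
      show ((clGenUnit p q a : (Cl p q)ˣ) : Cl p q) = clGen p q a from rfl, subsetRep_clGen, ht,
      List.toFinset_cons, smul_smul]
    simp

/-- Distinct monomials move the vacuum vector to distinct coordinate axes; this separates them and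
makes the coefficient of 1 well defined. -/
lemma subsetRep_clMonomial (I : Finset (Fin (p + q))) :
    ∃ s : ℤˣ, subsetRep p q (clMonomial p q I : Cl p q) (Pi.single ∅ 1) =
      ((s : ℤ) : ℝ) • Pi.single I 1 := by
  simpa [clMonomial_eq_clProd] using subsetRep_clProd (p := p) (q := q) (Finset.sort_nodup I (· ≤ ·))

/-- The coefficient of `1` in the expansion of an element in basis monomials. -/
noncomputable def unitCoeff (p q : ℕ) : Cl p q →ₗ[ℝ] ℝ :=
  LinearMap.proj ∅ ∘ₗ LinearMap.applyₗ (Pi.single ∅ 1) ∘ₗ (subsetRep p q).toLinearMap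

lemma unitCoeff_apply (x : Cl p q) : unitCoeff p q x = subsetRep p q x (Pi.single ∅ 1) ∅ := rfl

lemma unitCoeff_one : unitCoeff p q 1 = 1 := by simp [unitCoeff_apply]

lemma unitCoeff_clMonomial {I : Finset (Fin (p + q))} (h : I ≠ ∅) :
    unitCoeff p q (clMonomial p q I : Cl p q) = 0 := by
  obtain ⟨s, hs⟩ := subsetRep_clMonomial (p := p) (q := q) I
  rw [unitCoeff_apply, hs]
  simp [Ne.symm h]

lemma unitCoeff_eq_zero {u : (Cl p q)ˣ} (hu : u ∈ monomialGroup p q) (h1 : u ≠ 1)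
    (h2 : u ≠ -1) : unitCoeff p q (u : Cl p q) = 0 := by
  obtain ⟨I, rfl | rfl⟩ := hu
  · exact unitCoeff_clMonomial fun h => h1 (by rw [h, clMonomial_empty])
  · rw [Units.val_neg, map_neg, unitCoeff_clMonomial fun h => h2 (by rw [h, clMonomial_empty]),
      neg_zero]

lemma clMonomial_injective : Function.Injective (clMonomial p q) := by
  intro I J h
  obtain ⟨s, hs⟩ := subsetRep_clMonomial (p := p) (q := q) I
  obtain ⟨t, ht⟩ := subsetRep_clMonomial (p := p) (q := q) J
  by_contra hIJ
  have e := congrFun (hs.symm.trans ((congrArg (fun u : (Cl p q)ˣ =>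
    subsetRep p q (u : Cl p q) (Pi.single ∅ 1)) h).trans ht)) I
  simp [hIJ] at e

lemma clMonomial_ne_neg (I J : Finset (Fin (p + q))) : clMonomial p q I ≠ -clMonomial p q J := by
  intro h
  obtain ⟨s, hs⟩ := subsetRep_clMonomial (p := p) (q := q) I
  obtain ⟨t, ht⟩ := subsetRep_clMonomial (p := p) (q := q) J
  have e1 := hs.symm.trans ((congrArg (fun u : (Cl p q)ˣ =>
    subsetRep p q (u : Cl p q) (Pi.single ∅ 1)) h))
  by_cases hIJ : I = J
  · subst hIJ
    have h1 := congrArg (fun u : (Cl p q)ˣ => (u : Cl p q)) h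
    have h2 : (2 : ℝ) • (clMonomial p q I : Cl p q) = 0 := by
      rw [two_smul]; nth_rewrite 1 [h1]; simp
    have h3 : (clMonomial p q I : Cl p q) = 0 :=
      (smul_eq_zero.1 h2).resolve_left two_ne_zero
    rw [h3] at hs
    have e := congrFun hs I
    rcases Int.units_eq_one_or s with rfl | rfl <;> simp at e
  · rw [Units.val_neg, map_neg, LinearMap.neg_apply, ht] at e1
    have e := congrFun e1 I
    simp [hIJ] at e

end Representation

/-! ### The signed count of squares as a Gaussian integer. -/

section GaussSum

variable {p q : ℕ}

/-- The real part of `(1 - i) (1 + i) ^ p (1 - i) ^ q`. -/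
def signatureGauss (p q : ℕ) : ℤ :=
  ((⟨1, -1⟩ : GaussianInt) * ((⟨1, 1⟩ : GaussianInt) ^ p * (⟨1, -1⟩ : GaussianInt) ^ q)).re

/-- The factor 1 - i turns the powers of i into the sign pattern +, +, -, - of reversal on their
real parts. The imaginary part is needed for the induction. -/
lemma one_sub_I_mul_I_pow (s : ℕ) : (⟨1, -1⟩ : GaussianInt) * (⟨0, 1⟩ : GaussianInt) ^ s =
    ⟨(-1) ^ (s.choose 2), -(-1) ^ ((s + 1).choose 2)⟩ := by
  induction s with
  | zero => rfl
  | succ s ih =>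
    have h : (s + 1 + 1).choose 2 = s.choose 2 + (2 * s + 1) := by
      rw [Nat.choose_succ_succ' (s + 1) 1, Nat.choose_succ_succ' s 1]
      simp only [Nat.choose_one_right, one_add_one_eq_two]
      ring
    rw [pow_succ, ← mul_assoc, ih, h, pow_add, pow_succ _ (2 * s), pow_mul]
    ext <;> simp

/-- Expanding ∏ (1 + ε_i i) over subsets gives the terms i^|I| ∏_{i ∈ I} ε_i; multiplying by 1 - i
and taking real parts gives the square signs. -/
lemma sum_squareSign : ∑ I : Finset (Fin (p + q)), ((squareSign p q I : ℤˣ) : ℤ) =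
    signatureGauss p q := by
  have h1 : ∏ i : Fin (p + q), (1 + (⟨0, ((sigSign p q i : ℤˣ) : ℤ)⟩ : GaussianInt)) =
      (⟨1, 1⟩ : GaussianInt) ^ p * (⟨1, -1⟩ : GaussianInt) ^ q := by
    rw [Fin.prod_univ_add]
    congr 1
    · rw [Finset.prod_congr rfl fun i _ => show _ = (⟨1, 1⟩ : GaussianInt) by
        ext <;> simp [sigSign]]
      simp
    · rw [Finset.prod_congr rfl fun i _ => show _ = (⟨1, -1⟩ : GaussianInt) by
        ext <;> simp [sigSign]]
      simp
  rw [signatureGauss, ← h1, Finset.prod_one_add, Finset.mul_sum,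
    show ∀ (s : Finset (Finset (Fin (p + q)))) (g : Finset (Fin (p + q)) → GaussianInt),
      (∑ I ∈ s, g I).re = ∑ I ∈ s, (g I).re from fun s g => by
        induction s using Finset.cons_induction with
        | empty => simp
        | cons a s ha ih => rw [Finset.sum_cons, Finset.sum_cons, Zsqrtd.re_add, ih], Finset.powerset_univ]
  refine Finset.sum_congr rfl fun I _ => ?_
  have h2 : ∏ i ∈ I, (⟨0, ((sigSign p q i : ℤˣ) : ℤ)⟩ : GaussianInt) =
      (⟨0, 1⟩ : GaussianInt) ^ I.card * ((∏ i ∈ I, ((sigSign p q i : ℤˣ) : ℤ) : ℤ) : GaussianInt) := by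
    rw [Int.cast_prod, ← Finset.prod_const, ← Finset.prod_mul_distrib]
    refine Finset.prod_congr rfl fun i _ => ?_
    ext <;> simp
  rw [h2, ← mul_assoc, one_sub_I_mul_I_pow, Zsqrtd.re_mul, Zsqrtd.re_intCast, Zsqrtd.im_intCast]
  simp [squareSign]

lemma signatureGauss_eq (p q k : ℕ) (hpq : p + q ≤ 9) (hsimple : ((p : ℤ) - q) % 4 ≠ 1)
    (hk : (k : ℤ) = q - radonHurwitz (q - p)) :
    ((((p : ℤ) - q) % 8 = 0 ∨ ((p : ℤ) - q) % 8 = 1 ∨ ((p : ℤ) - q) % 8 = 2) →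
      p + q = 2 * k ∧ signatureGauss p q = 2 ^ k) ∧
    ((((p : ℤ) - q) % 8 = 3 ∨ ((p : ℤ) - q) % 8 = 7) →
      p + q = 2 * k + 1 ∧ signatureGauss p q = 0) ∧
    ((((p : ℤ) - q) % 8 = 4 ∨ ((p : ℤ) - q) % 8 = 5 ∨ ((p : ℤ) - q) % 8 = 6) →
      p + q = 2 * k + 2 ∧ signatureGauss p q = -2 ^ (k + 1)) := by
  have hp : p ≤ 9 := by omega
  have hq : q ≤ 9 - p := by omega
  have hk' : k ≤ 9 := by
    simp only [radonHurwitz] at hk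
    split_ifs at hk <;> omega
  have key : ∀ p ∈ Finset.range 10, ∀ q ∈ Finset.range (10 - p), ((p : ℤ) - q) % 4 ≠ 1 → ∀ k ∈ Finset.range 10,
      (k : ℤ) = q - radonHurwitz (q - p) →
    ((((p : ℤ) - q) % 8 = 0 ∨ ((p : ℤ) - q) % 8 = 1 ∨ ((p : ℤ) - q) % 8 = 2) →
      p + q = 2 * k ∧ signatureGauss p q = 2 ^ k) ∧
    ((((p : ℤ) - q) % 8 = 3 ∨ ((p : ℤ) - q) % 8 = 7) →
      p + q = 2 * k + 1 ∧ signatureGauss p q = 0) ∧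
    ((((p : ℤ) - q) % 8 = 4 ∨ ((p : ℤ) - q) % 8 = 5 ∨ ((p : ℤ) - q) % 8 = 6) →
      p + q = 2 * k + 2 ∧ signatureGauss p q = -2 ^ (k + 1)) := by
    -- A finite check; the bound p + q ≤ 9 serves only to make it finite.
    decide +kernel
  exact key p (Finset.mem_range.2 (by omega)) q (Finset.mem_range.2 (by omega)) hsimple k
    (Finset.mem_range.2 (by omega)) hk

end GaussSum

/-! ### Counting signed monomials and their squares. -/

section Counting

open Classical in
/-- The basis monomials up to sign, as a finite set. -/
noncomputable def signedMonomials (p q : ℕ) : Finset (Cl p q)ˣ :=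
  Finset.univ.image (clMonomial p q) ∪ Finset.univ.image fun I => -clMonomial p q I

variable {p q : ℕ}

lemma mem_signedMonomials {u : (Cl p q)ˣ} :
    u ∈ signedMonomials p q ↔ u ∈ monomialGroup p q := by
  simp only [signedMonomials, Finset.mem_union, Finset.mem_image, Finset.mem_univ, true_and,
    mem_monomialGroup, exists_or, eq_comm]

lemma sum_signedMonomials {M : Type*} [AddCommMonoid M] (g : (Cl p q)ˣ → M) :
    ∑ u ∈ signedMonomials p q, g u =
      ∑ I, g (clMonomial p q I) + ∑ I, g (-clMonomial p q I) := by
  classical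
  rw [signedMonomials, Finset.sum_union, Finset.sum_image clMonomial_injective.injOn,
    Finset.sum_image fun I _ J _ h => clMonomial_injective (neg_injective h)]
  rw [Finset.disjoint_left]
  intro u h1 h2
  obtain ⟨I, -, rfl⟩ := Finset.mem_image.1 h1
  obtain ⟨J, -, h⟩ := Finset.mem_image.1 h2
  exact clMonomial_ne_neg I J h.symm

lemma card_signedMonomials : (signedMonomials p q).card = 2 ^ (p + q + 1) := by
  rw [Finset.card_eq_sum_ones, sum_signedMonomials]
  simp [pow_succ, mul_two]

lemma neg_one_ne_one_units : (-1 : (Cl p q)ˣ) ≠ 1 := by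
  have := clMonomial_ne_neg (p := p) (q := q) ∅ ∅
  rw [clMonomial_empty] at this
  exact this.symm

open Classical in
/-- The square of an involution or anti-involution as a sign. -/
noncomputable def squareInt (u : (Cl p q)ˣ) : ℤ := if u * u = 1 then 1 else -1

lemma squareInt_neg (u : (Cl p q)ˣ) : squareInt (-u) = squareInt u := by
  rw [squareInt, squareInt, neg_mul_neg]

lemma squareInt_clMonomial (I : Finset (Fin (p + q))) :
    squareInt (clMonomial p q I) = squareSign p q I := by
  rw [squareInt, clMonomial_mul_self]
  rcases Int.units_eq_one_or (squareSign p q I) with h | h <;> simp [h, neg_one_ne_one_units]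

lemma sum_squareInt : ∑ u ∈ signedMonomials p q, squareInt u = 2 * signatureGauss p q := by
  rw [sum_signedMonomials]
  simp only [squareInt_neg, squareInt_clMonomial, sum_squareSign]
  ring

end Counting

/-! ### The groups E (`signedFactorGroup`) and H (`commutantGroup`). -/

namespace IdempotentFactors

variable {p q k : ℕ} (F : IdempotentFactors p q k)

/-- The group generated by the monomials of the idempotent. -/
noncomputable def factorGroup : Subgroup (Cl p q)ˣ :=
  Subgroup.closure (Set.range fun i => clMonomial p q (F.idx i))

lemma clMonomial_mem_factorGroup (i : Fin k) : clMonomial p q (F.idx i) ∈ F.factorGroup :=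
  Subgroup.subset_closure ⟨i, rfl⟩

lemma factorGroup_le : F.factorGroup ≤ monomialGroup p q := by
  rw [factorGroup, Subgroup.closure_le]
  rintro _ ⟨i, rfl⟩
  exact clMonomial_mem _

/-- The signed monomials that commute with all monomials of the idempotent. -/
noncomputable def commutantGroup : Subgroup (Cl p q)ˣ :=
  monomialGroup p q ⊓ Subgroup.centralizer (Set.range fun i => clMonomial p q (F.idx i))

lemma mem_commutantGroup {u : (Cl p q)ˣ} : u ∈ F.commutantGroup ↔
    u ∈ monomialGroup p q ∧ ∀ i, Commute u (clMonomial p q (F.idx i)) := by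
  simp only [commutantGroup, Subgroup.mem_inf, Subgroup.mem_centralizer_iff,
    Set.forall_mem_range, Commute, SemiconjBy, eq_comm]

lemma commutantGroup_le : F.commutantGroup ≤ monomialGroup p q := inf_le_left

lemma neg_mem_commutantGroup {u : (Cl p q)ˣ} (h : u ∈ F.commutantGroup) :
    -u ∈ F.commutantGroup := by
  rw [mem_commutantGroup] at h ⊢
  exact ⟨neg_mem_monomialGroup h.1, fun i => (h.2 i).neg_left⟩

lemma factorGroup_le_commutantGroup : F.factorGroup ≤ F.commutantGroup := by
  rw [factorGroup, Subgroup.closure_le]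
  rintro _ ⟨i, rfl⟩
  exact F.mem_commutantGroup.2 ⟨clMonomial_mem _, fun j => F.comm i j⟩

lemma mul_self_of_mem_factorGroup {u : (Cl p q)ˣ} (hu : u ∈ F.factorGroup) : u * u = 1 :=
  (monomialGroup_mul_self (F.factorGroup_le hu)).resolve_right fun h =>
    F.neg_one_notMem (h ▸ mul_mem hu hu)

instance : Finite F.factorGroup :=
  Nat.finite_of_card_ne_zero (by rw [factorGroup, F.card_group]; positivity)

/-- The group generated by `-1` and the monomials of the idempotent. -/
noncomputable def signedFactorGroup : Subgroup (Cl p q)ˣ where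
  carrier := {u | u ∈ F.factorGroup ∨ -u ∈ F.factorGroup}
  one_mem' := Or.inl (one_mem _)
  mul_mem' := by
    rintro u v (hu | hu) (hv | hv)
    · exact Or.inl (mul_mem hu hv)
    · exact Or.inr (by simpa using mul_mem hu hv)
    · exact Or.inr (by simpa using mul_mem hu hv)
    · exact Or.inl (by simpa using mul_mem hu hv)
  inv_mem' := by
    rintro u (hu | hu)
    · exact Or.inl (inv_mem hu)
    · exact Or.inr (by simpa using inv_mem hu)

lemma mem_signedFactorGroup {u : (Cl p q)ˣ} :
    u ∈ F.signedFactorGroup ↔ u ∈ F.factorGroup ∨ -u ∈ F.factorGroup := Iff.rfl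

lemma signedFactorGroup_le : F.signedFactorGroup ≤ F.commutantGroup := by
  rintro u (h | h)
  · exact F.factorGroup_le_commutantGroup h
  · rw [← neg_neg u]
    exact F.neg_mem_commutantGroup (F.factorGroup_le_commutantGroup h)

lemma mul_self_of_mem_signedFactorGroup {u : (Cl p q)ˣ} (hu : u ∈ F.signedFactorGroup) :
    u * u = 1 := by
  rcases hu with h | h
  · exact F.mul_self_of_mem_factorGroup h
  · simpa using F.mul_self_of_mem_factorGroup h

open Classical in
/-- The elements of `commutantGroup` as a finite set. -/
noncomputable def commutantFinset : Finset (Cl p q)ˣ :=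
  (signedMonomials p q).filter (· ∈ F.commutantGroup)

lemma mem_commutantFinset {u : (Cl p q)ˣ} : u ∈ F.commutantFinset ↔ u ∈ F.commutantGroup := by
  classical
  rw [commutantFinset, Finset.mem_filter, mem_signedMonomials]
  exact and_iff_right_of_imp fun h => F.commutantGroup_le h

open Classical in
/-- The elements of `signedFactorGroup` as a finite set. -/
noncomputable def signedFactorFinset : Finset (Cl p q)ˣ :=
  (signedMonomials p q).filter (· ∈ F.signedFactorGroup)

lemma mem_signedFactorFinset {u : (Cl p q)ˣ} :
    u ∈ F.signedFactorFinset ↔ u ∈ F.signedFactorGroup := by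
  classical
  rw [signedFactorFinset, Finset.mem_filter, mem_signedMonomials]
  exact and_iff_right_of_imp fun h => F.commutantGroup_le (F.signedFactorGroup_le h)

lemma card_signedFactorFinset : F.signedFactorFinset.card = 2 ^ (k + 1) := by
  classical
  have hfin : (F.factorGroup : Set (Cl p q)ˣ).Finite :=
    Set.finite_coe_iff.1 (inferInstanceAs (Finite F.factorGroup))
  have hc : hfin.toFinset.card = 2 ^ k := by
    rw [← F.card_group, ← Set.ncard_eq_toFinset_card _ hfin]
    exact (Nat.card_coe_set_eq _).symm
  have h : F.signedFactorFinset = hfin.toFinset ∪ hfin.toFinset.image Neg.neg := by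
    ext u
    simp only [mem_signedFactorFinset, mem_signedFactorGroup, Finset.mem_union,
      Set.Finite.mem_toFinset, SetLike.mem_coe, Finset.mem_image]
    refine or_congr Iff.rfl ⟨fun h => ⟨_, h, neg_neg u⟩, ?_⟩
    rintro ⟨v, hv, rfl⟩
    rwa [neg_neg]
  rw [h, Finset.card_union_of_disjoint, Finset.card_image_of_injective _ neg_injective, hc,
    pow_succ, mul_two]
  rw [Finset.disjoint_left]
  intro u h1 h2
  obtain ⟨v, hv, rfl⟩ := Finset.mem_image.1 h2
  simp only [Set.Finite.mem_toFinset, SetLike.mem_coe] at hv h1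
  have := mul_mem h1 (inv_mem hv)
  rw [neg_mul, mul_inv_cancel] at this
  exact F.neg_one_notMem this

lemma exists_anticommute {u : (Cl p q)ˣ} (hu : u ∈ monomialGroup p q)
    (h : u ∉ F.commutantGroup) : ∃ i, ¬ Commute u (clMonomial p q (F.idx i)) := by
  by_contra! h'
  exact h (F.mem_commutantGroup.2 ⟨hu, h'⟩)

lemma squareInt_mul_of_not_commute {u v : (Cl p q)ˣ} (hu : u ∈ monomialGroup p q)
    (hv : v ∈ monomialGroup p q) (hv2 : v * v = 1) (h : ¬ Commute u v) :
    squareInt (u * v) = -squareInt u := by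
  have h1 : u * v = -(v * u) := (monomialGroup_mul_comm hu hv).resolve_left h
  have h2 : u * v * (u * v) = -(u * u) := by
    calc u * v * (u * v) = -(v * u) * (u * v) := by rw [h1]
      _ = -(v * (u * u) * v) := by simp [mul_assoc]
      _ = -(u * u) := by
        rcases monomialGroup_mul_self hu with h | h <;> simp [h, hv2]
  rw [squareInt, squareInt, h2]
  rcases monomialGroup_mul_self hu with h | h <;> simp [h, neg_one_ne_one_units]

/-- A sign-reversing involution cancels the terms outside H: multiply u by a monomial of f with
which it anticommutes. -/
lemma sum_squareInt_commutant :
    ∑ u ∈ F.commutantFinset, squareInt u = 2 * signatureGauss p q := by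
  classical
  rw [← sum_squareInt, ← Finset.sum_filter_add_sum_filter_not (signedMonomials p q)
    (· ∈ F.commutantGroup)]
  refine (add_eq_left.2 ?_).symm
  -- The choice depends only on which factors anticommute with u. Multiplication by a factor does
  -- not change this, so the same factor is chosen again and the map is an involution.
  let sel (P : Fin k → Prop) : (Cl p q)ˣ :=
    if h : ∃ i, P i then clMonomial p q (F.idx (Classical.choose h)) else 1
  have hsel (P : Fin k → Prop) (h : ∃ i, P i) : ∃ i, P i ∧ sel P = clMonomial p q (F.idx i) :=
    ⟨_, Classical.choose_spec h, dif_pos h⟩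
  have hcomm (u : (Cl p q)ˣ) (i j : Fin k) :
      Commute (u * clMonomial p q (F.idx j)) (clMonomial p q (F.idx i)) ↔
        Commute u (clMonomial p q (F.idx i)) := by
    refine ⟨fun h => ?_, fun h => h.mul_left (F.comm j i)⟩
    simpa [mul_assoc] using h.mul_left (F.comm j i).inv_left
  let P (u : (Cl p q)ˣ) (i : Fin k) : Prop := ¬ Commute u (clMonomial p q (F.idx i))
  have hP (u : (Cl p q)ˣ) (hu : ∃ i, P u i) : P (u * sel (P u)) = P u := by
    obtain ⟨j, -, hj⟩ := hsel _ hu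
    funext i
    simp only [hj, P, hcomm]
  have hmem (u : (Cl p q)ˣ) (hu : u ∈ (signedMonomials p q).filter (· ∉ F.commutantGroup)) :
      u ∈ monomialGroup p q ∧ ∃ i, P u i := by
    rw [Finset.mem_filter, mem_signedMonomials] at hu
    exact ⟨hu.1, F.exists_anticommute hu.1 hu.2⟩
  refine Finset.sum_involution (fun u _ => u * sel (P u)) ?_ ?_ ?_ ?_
  · intro u hu
    obtain ⟨h1, h2⟩ := hmem u hu
    obtain ⟨j, hj, hj'⟩ := hsel _ h2
    rw [hj', squareInt_mul_of_not_commute h1 (clMonomial_mem _) (F.sq_eq_one j) hj, add_neg_cancel]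
  · intro u hu _ h
    obtain ⟨h1, h2⟩ := hmem u hu
    obtain ⟨j, hj, hj'⟩ := hsel _ h2
    rw [hj', mul_eq_left] at h
    exact hj (h ▸ Commute.one_right u)
  · intro u hu
    obtain ⟨h1, h2⟩ := hmem u hu
    obtain ⟨j, hj, hj'⟩ := hsel _ h2
    rw [Finset.mem_filter, mem_signedMonomials, hj']
    refine ⟨mul_mem h1 (clMonomial_mem _), fun h => hj ?_⟩
    exact (hcomm u j j).1 ((F.mem_commutantGroup.1 h).2 j)
  · intro u hu
    obtain ⟨h1, h2⟩ := hmem u hu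
    obtain ⟨j, hj, hj'⟩ := hsel _ h2
    rw [hP u h2, hj', mul_assoc, F.sq_eq_one, mul_one]

/-- If the signed count of squares is extremal, every monomial outside the group of the
idempotent squares to `-1`. -/
lemma mul_self_eq_neg_one
    (hsum : 2 * signatureGauss p q = 2 * 2 ^ (k + 1) - (F.commutantFinset.card : ℤ))
    {u : (Cl p q)ˣ} (hu : u ∈ F.commutantGroup) (h : u ∉ F.signedFactorGroup) :
    u * u = -1 := by
  classical
  have hsub : F.signedFactorFinset ⊆ F.commutantFinset := fun v hv =>
    F.mem_commutantFinset.2 (F.signedFactorGroup_le (F.mem_signedFactorFinset.1 hv))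
  -- The summand is nonnegative and equals 2 on E. The total over H is already attained on E, so all
  -- other terms vanish.
  have h1 : ∑ v ∈ F.commutantFinset, (squareInt v + 1) = 2 * 2 ^ (k + 1) := by
    rw [Finset.sum_add_distrib, F.sum_squareInt_commutant, hsum]
    simp
  have h2 : ∑ v ∈ F.signedFactorFinset, (squareInt v + 1) = 2 * 2 ^ (k + 1) := by
    rw [Finset.sum_congr rfl fun v hv => show _ = (2 : ℤ) by
      rw [squareInt, if_pos (F.mul_self_of_mem_signedFactorGroup (F.mem_signedFactorFinset.1 hv))]
      norm_num]
    rw [Finset.sum_const, F.card_signedFactorFinset]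
    simp [mul_comm]
  have h3 : ∑ v ∈ F.commutantFinset \ F.signedFactorFinset, (squareInt v + 1) = 0 := by
    have := Finset.sum_sdiff (f := fun v => squareInt v + 1) hsub
    omega
  have h4 := (Finset.sum_eq_zero_iff_of_nonneg (fun v _ => by
    rw [squareInt]; split <;> norm_num)).1 h3 u (by
      rw [Finset.mem_sdiff, F.mem_commutantFinset, F.mem_signedFactorFinset]; exact ⟨hu, h⟩)
  refine (monomialGroup_mul_self (F.commutantGroup_le hu)).resolve_left fun h5 => ?_
  rw [squareInt, if_pos h5] at h4
  norm_num at h4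

end IdempotentFactors

/-! ### Orders of groups generated by commuting involutions. -/

lemma image_setOf_mem_cons {ι G : Type*} (t : ι → G) (a : ι) (l : List ι) :
    t '' {i | i ∈ a :: l} = insert (t a) (t '' {i | i ∈ l}) := by
  rw [← Set.image_insert_eq]
  congr 1
  ext i
  simp

section Involutions

variable {G : Type*} [Group G]

/-- As u is an involution commuting with C = ⟨S⟩, the set C ∪ uC is already closed under the group
operations. -/
lemma mem_closure_insert_of_involution {u : G} {S : Set G} (hu : u * u = 1)
    (hc : ∀ s ∈ S, Commute u s) {v : G} (hv : v ∈ Subgroup.closure (insert u S)) :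
    v ∈ Subgroup.closure S ∨ u * v ∈ Subgroup.closure S := by
  have hC {w : G} (hw : w ∈ Subgroup.closure S) : Commute u w := by
    induction hw using Subgroup.closure_induction with
    | mem x hx => exact hc x hx
    | one => exact Commute.one_right u
    | mul x y _ _ hx hy => exact hx.mul_right hy
    | inv x _ hx => exact hx.inv_right
  have huu (w : G) : u * (u * w) = w := by rw [← mul_assoc, hu, one_mul]
  have hC' {w : G} (hw : u * w ∈ Subgroup.closure S) : Commute u w := by
    have h := hC hw
    have h2 : Commute u (u * (u * w)) := (Commute.refl u).mul_right h
    rwa [huu] at h2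
  induction hv using Subgroup.closure_induction with
  | mem x hx =>
    rcases hx with rfl | hx
    · right; rw [hu]; exact one_mem _
    · exact Or.inl (Subgroup.subset_closure hx)
  | one => exact Or.inl (one_mem _)
  | mul x y _ _ hx hy =>
    rcases hx with hx | hx <;> rcases hy with hy | hy
    · exact Or.inl (mul_mem hx hy)
    · right
      rw [← mul_assoc, (hC hx).eq, mul_assoc]
      exact mul_mem hx hy
    · right
      rw [← mul_assoc]
      exact mul_mem hx hy
    · left
      have h := mul_mem hx hy
      rwa [mul_assoc, ← mul_assoc x u y, ← (hC' hx).eq, mul_assoc, huu] at h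
  | inv x _ hx =>
    rcases hx with hx | hx
    · exact Or.inl (inv_mem hx)
    · right
      have h := inv_mem hx
      rwa [mul_inv_rev, inv_eq_of_mul_eq_one_left hu, ← (hC' hx).inv_right.eq] at h

lemma finite_and_card_closure_insert_le {u : G} {S : Set G} (hu : u * u = 1)
    (hc : ∀ s ∈ S, Commute u s) (hfin : (Subgroup.closure S : Set G).Finite) :
    (Subgroup.closure (insert u S) : Set G).Finite ∧
      Nat.card (Subgroup.closure (insert u S)) ≤ 2 * Nat.card (Subgroup.closure S) := by
  have hsub : (Subgroup.closure (insert u S) : Set G) ⊆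
      Subgroup.closure S ∪ (u * ·) '' (Subgroup.closure S : Set G) := by
    intro v hv
    rcases mem_closure_insert_of_involution hu hc hv with h | h
    · exact Or.inl h
    · exact Or.inr ⟨u * v, h, by simp only [← mul_assoc, hu, one_mul]⟩
  have hfin' := hfin.union (hfin.image (u * ·))
  refine ⟨hfin'.subset hsub, ?_⟩
  calc Nat.card (Subgroup.closure (insert u S))
      = (Subgroup.closure (insert u S) : Set G).ncard := Nat.card_coe_set_eq _
    _ ≤ _ := Set.ncard_le_ncard hsub hfin'
    _ ≤ _ := Set.ncard_union_le _ _
    _ ≤ (Subgroup.closure S : Set G).ncard + (Subgroup.closure S : Set G).ncard :=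
        Nat.add_le_add_left (Set.ncard_image_le hfin) _
    _ = 2 * Nat.card (Subgroup.closure S) := by
        rw [← two_mul]; rfl

lemma finite_and_card_closure_le {ι : Type*} (t : ι → G) (hsq : ∀ i, t i * t i = 1)
    (hc : ∀ i j, Commute (t i) (t j)) (l : List ι) :
    (Subgroup.closure (t '' {i | i ∈ l}) : Set G).Finite ∧
      Nat.card (Subgroup.closure (t '' {i | i ∈ l})) ≤ 2 ^ l.length := by
  induction l with
  | nil => simp
  | cons a l ih =>
    rw [image_setOf_mem_cons]
    have h := finite_and_card_closure_insert_le (hsq a) (S := t '' {i | i ∈ l})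
      (by rintro _ ⟨i, -, rfl⟩; exact hc a i) ih.1
    refine ⟨h.1, h.2.trans ?_⟩
    rw [List.length_cons, pow_succ']
    exact Nat.mul_le_mul_left 2 ih.2

end Involutions

/-! ### The coefficient of 1 in the idempotent. -/

section UnitCoeff

variable {p q : ℕ}

/-- The expanded product involves only monomials of the generated group, and the hypotheses on order
and -1 leave the empty product as the only source of ±1. The vanishing statement carries the
induction: it is applied to the next generator. -/
lemma unitCoeff_list_prod {ι : Type*} (t : ι → (Cl p q)ˣ) (s : ι → ℝ)
    (ht : ∀ i, t i ∈ monomialGroup p q) (hsq : ∀ i, t i * t i = 1)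
    (hc : ∀ i j, Commute (t i) (t j)) (l : List ι)
    (hcard : Nat.card (Subgroup.closure (t '' {i | i ∈ l})) = 2 ^ l.length)
    (hneg : -1 ∉ Subgroup.closure (t '' {i | i ∈ l})) :
    (∀ u ∈ monomialGroup p q, u ∉ Subgroup.closure (t '' {i | i ∈ l}) →
      -u ∉ Subgroup.closure (t '' {i | i ∈ l}) →
      unitCoeff p q (u * (l.map fun i => (1 / 2 : ℝ) • ((1 : Cl p q) + s i • (t i : Cl p q))).prod)
        = 0) ∧
    unitCoeff p q (l.map fun i => (1 / 2 : ℝ) • ((1 : Cl p q) + s i • (t i : Cl p q))).prod =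
      (1 / 2) ^ l.length := by
  induction l with
  | nil =>
    refine ⟨fun u hu h1 h2 => ?_, by simp [unitCoeff_one]⟩
    simp only [List.not_mem_nil, Set.ofPred_false, Set.image_empty, Subgroup.closure_empty,
      Subgroup.mem_bot] at h1 h2
    simpa using unitCoeff_eq_zero hu h1 fun h => h2 (by rw [h, neg_neg])
  | cons a l ih =>
    rw [image_setOf_mem_cons] at hcard hneg
    rw [image_setOf_mem_cons]
    set C := Subgroup.closure (t '' {i | i ∈ l}) with hC
    set C' := Subgroup.closure (insert (t a) (t '' {i | i ∈ l})) with hC'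
    have hle : C ≤ C' := Subgroup.closure_mono (Set.subset_insert _ _)
    have ha : t a ∈ C' := Subgroup.subset_closure (Set.mem_insert _ _)
    have h1 := finite_and_card_closure_le t hsq hc l
    have h2 := finite_and_card_closure_insert_le (hsq a) (S := t '' {i | i ∈ l})
      (by rintro _ ⟨i, -, rfl⟩; exact hc a i) h1.1
    rw [← hC, ← hC', hcard, List.length_cons, pow_succ'] at h2
    rw [← hC] at h1
    -- Each generator at most doubles the order, so the maximal order 2^(length) forces maximality
    -- at every stage.
    have h3 : Nat.card C = 2 ^ l.length := le_antisymm h1.2 (by omega)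
    obtain ⟨ih1, ih2⟩ := ih h3 fun h => hneg (hle h)
    have ha1 : t a ∉ C := by
      intro h
      have : C' = C := by
        refine le_antisymm ?_ hle
        rw [hC', Subgroup.closure_le]
        exact Set.insert_subset h Subgroup.subset_closure
      rw [this, h3, List.length_cons, pow_succ'] at hcard
      have := Nat.pow_pos (n := l.length) (show 0 < 2 by norm_num)
      omega
    have ha2 : -t a ∉ C := by
      intro h
      have := mul_mem ha (hle h)
      rw [mul_neg, hsq a] at this
      exact hneg this
    refine ⟨fun u hu hu1 hu2 => ?_, ?_⟩
    · have e1 := ih1 u hu (fun h => hu1 (hle h)) fun h => hu2 (hle h)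
      have e2 := ih1 (u * t a) (mul_mem hu (ht a))
        (fun h => hu1 (by simpa [mul_assoc, hsq a] using mul_mem (hle h) ha))
        (fun h => hu2 (by simpa [mul_assoc, hsq a] using mul_mem (hle h) ha))
      rw [List.map_cons, List.prod_cons, smul_mul_assoc, mul_smul_comm, map_smul, add_mul, mul_add,
        map_add, one_mul, e1, smul_mul_assoc, mul_smul_comm, map_smul, ← mul_assoc,
        ← Units.val_mul, e2]
      simp
    · have e := ih1 (t a) (ht a) ha1 ha2
      rw [List.map_cons, List.prod_cons, smul_mul_assoc, map_smul, add_mul, map_add, one_mul,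
        smul_mul_assoc, map_smul, e, ih2, List.length_cons, pow_succ']
      simp

end UnitCoeff

/-! ### The action of monomials on f. -/

namespace IdempotentFactors

variable {p q k : ℕ} (F : IdempotentFactors p q k)

/-- The factor `½(1 ± e_{T_i})` of the idempotent. -/
noncomputable def factor (i : Fin k) : Cl p q :=
  (1 / 2 : ℝ) • ((1 : Cl p q) + ((F.sgn i : ℤ) : ℝ) • (clMonomial p q (F.idx i) : Cl p q))

lemma f_eq : F.f = ((List.finRange k).map F.factor).prod := by
  rw [f, List.ofFn_eq_map]
  rfl

lemma f_ne_zero : F.f ≠ 0 := by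
  have hS : (fun i => clMonomial p q (F.idx i)) '' {i | i ∈ List.finRange k} =
      Set.range fun i => clMonomial p q (F.idx i) := by
    simp
  have h := (unitCoeff_list_prod (fun i => clMonomial p q (F.idx i))
    (fun i => ((F.sgn i : ℤ) : ℝ)) (fun i => clMonomial_mem _) F.sq_eq_one F.comm
    (List.finRange k) (by rw [hS, F.card_group, List.length_finRange])
    (by rw [hS]; exact F.neg_one_notMem)).2
  intro h0
  rw [f_eq] at h0
  change unitCoeff p q ((List.finRange k).map F.factor).prod = _ at h
  rw [h0, map_zero] at h
  exact (pow_pos (by norm_num) _).ne h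

lemma commute_factor {x : Cl p q} {i : Fin k}
    (h : Commute x (clMonomial p q (F.idx i) : Cl p q)) : Commute x (F.factor i) :=
  ((Commute.one_right _).add_right (h.smul_right _)).smul_right _

lemma commute_clMonomial_factor (i j : Fin k) :
    Commute (clMonomial p q (F.idx i) : Cl p q) (F.factor j) :=
  F.commute_factor (F.comm i j).units_val

lemma commute_f {u : (Cl p q)ˣ} (hu : u ∈ F.commutantGroup) : Commute (u : Cl p q) F.f := by
  rw [f_eq]
  refine Commute.list_prod_right _ _ fun y hy => ?_
  obtain ⟨i, -, rfl⟩ := List.mem_map.1 hy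
  exact F.commute_factor ((F.mem_commutantGroup.1 hu).2 i).units_val

lemma clMonomial_mul_factor (i : Fin k) : (clMonomial p q (F.idx i) : Cl p q) * F.factor i =
    ((F.sgn i : ℤ) : ℝ) • F.factor i := by
  have h : (clMonomial p q (F.idx i) : Cl p q) * clMonomial p q (F.idx i) = 1 := by
    rw [← Units.val_mul, F.sq_eq_one, Units.val_one]
  rw [factor, mul_smul_comm, mul_add, mul_smul_comm, h, mul_one]
  rcases Int.units_eq_one_or (F.sgn i) with h | h <;> rw [h] <;> simp <;> module

lemma clMonomial_mul_f (i : Fin k) : (clMonomial p q (F.idx i) : Cl p q) * F.f =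
    ((F.sgn i : ℤ) : ℝ) • F.f := by
  have key : ∀ l : List (Fin k), i ∈ l →
      (clMonomial p q (F.idx i) : Cl p q) * (l.map F.factor).prod =
        ((F.sgn i : ℤ) : ℝ) • (l.map F.factor).prod := by
    intro l
    induction l with
    | nil => simp
    | cons a l ih =>
      intro h
      rw [List.map_cons, List.prod_cons]
      by_cases hia : i = a
      · subst hia
        rw [← mul_assoc, clMonomial_mul_factor, smul_mul_assoc]
      · rw [← mul_assoc, (F.commute_clMonomial_factor i a).eq, mul_assoc,
          ih ((List.mem_cons.1 h).resolve_left hia), mul_smul_comm]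
  rw [f_eq]
  exact key _ (List.mem_finRange i)

lemma f_mul_clMonomial (i : Fin k) : F.f * (clMonomial p q (F.idx i) : Cl p q) =
    ((F.sgn i : ℤ) : ℝ) • F.f := by
  rw [← clMonomial_mul_f]
  exact (F.commute_f (F.factorGroup_le_commutantGroup (F.clMonomial_mem_factorGroup i))).eq.symm

lemma mul_f_of_mem_factorGroup {u : (Cl p q)ˣ} (hu : u ∈ F.factorGroup) :
    (u : Cl p q) * F.f = F.f ∨ (u : Cl p q) * F.f = -F.f := by
  induction hu using Subgroup.closure_induction with
  | mem x hx =>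
    obtain ⟨i, rfl⟩ := hx
    rw [F.clMonomial_mul_f i]
    rcases Int.units_eq_one_or (F.sgn i) with h | h <;> simp [h]
  | one => simp
  | mul x y _ _ hx hy =>
    rw [Units.val_mul, mul_assoc]
    rcases hy with hy | hy <;> rcases hx with hx | hx <;> simp [hx, hy]
  | inv x _ hx =>
    have : F.f = ((x⁻¹ : (Cl p q)ˣ) : Cl p q) * ((x : Cl p q) * F.f) := by simp
    rcases hx with hx | hx <;> rw [hx] at this
    · exact Or.inl this.symm
    · right; rw [mul_neg] at this; rw [this, neg_neg, ← this]

lemma mul_f_of_mem_signedFactorGroup {u : (Cl p q)ˣ} (hu : u ∈ F.signedFactorGroup) :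
    (u : Cl p q) * F.f = F.f ∨ (u : Cl p q) * F.f = -F.f := by
  rcases hu with h | h
  · exact F.mul_f_of_mem_factorGroup h
  · have := F.mul_f_of_mem_factorGroup h
    rw [Units.val_neg, neg_mul, neg_eq_iff_eq_neg, neg_inj] at this
    exact this.symm

/-- A factor monomial t acts on f by the same sign from either side, so evaluating f u t f and -f t
u f gives f u f = -f u f. -/
lemma f_mul_mul_f_of_notMem {u : (Cl p q)ˣ} (hu : u ∈ monomialGroup p q)
    (h : u ∉ F.commutantGroup) : F.f * u * F.f = 0 := by
  obtain ⟨i, hi⟩ := F.exists_anticommute hu h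
  have h1 : u * clMonomial p q (F.idx i) = -(clMonomial p q (F.idx i) * u) :=
    (monomialGroup_mul_comm hu (clMonomial_mem _)).resolve_left hi
  have h2 : (u : Cl p q) * clMonomial p q (F.idx i) = -(clMonomial p q (F.idx i) * u) := by
    simpa using congrArg Units.val h1
  have h3 : F.f * (u * clMonomial p q (F.idx i)) * F.f = ((F.sgn i : ℤ) : ℝ) • (F.f * u * F.f) := by
    rw [mul_assoc, mul_assoc, clMonomial_mul_f, mul_smul_comm, mul_smul_comm, mul_assoc]
  have h4 : F.f * (u * clMonomial p q (F.idx i)) * F.f =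
      -(((F.sgn i : ℤ) : ℝ) • (F.f * u * F.f)) := by
    rw [h2, mul_neg, neg_mul, ← mul_assoc, f_mul_clMonomial, smul_mul_assoc, smul_mul_assoc]
  have h5 : (2 * ((F.sgn i : ℤ) : ℝ)) • (F.f * u * F.f) = 0 := by
    rw [mul_smul, two_smul]
    nth_rewrite 1 [← h3]
    rw [h4, neg_add_cancel]
  exact (smul_eq_zero.1 h5).resolve_left (by simp)

lemma f_mul_mul_f_of_mem {u : (Cl p q)ˣ} (hu : u ∈ F.commutantGroup) :
    F.f * u * F.f = u * F.f := by
  rw [← (F.commute_f hu).eq, mul_assoc, F.isIdempotentElem_f.eq]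

end IdempotentFactors

/-! ### The corner ring K and its spanning monomials. -/

namespace IdempotentFactors

variable {p q k : ℕ} (F : IdempotentFactors p q k)

lemma K_ext {x y : F.K} (h : x.1 = y.1) : x = y := Subtype.ext h

lemma val_one : (1 : F.K).1 = F.f := rfl

lemma val_mul (x y : F.K) : (x * y).1 = x.1 * y.1 := rfl

lemma val_neg (x : F.K) : (-x).1 = -x.1 := rfl

instance : Nontrivial F.K := ⟨1, 0, fun h => F.f_ne_zero (congrArg Subtype.val h)⟩

/-- The projection `x ↦ f x f` of the Clifford algebra onto the ring `K`. -/
noncomputable def toCorner : Cl p q →ₗ[ℝ] F.K where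
  toFun x := ⟨F.f * x * F.f, ⟨x, rfl⟩⟩
  map_add' x y := F.K_ext (by
    change F.f * (x + y) * F.f = F.f * x * F.f + F.f * y * F.f
    rw [mul_add, add_mul])
  map_smul' c x := F.K_ext (by
    change F.f * (c • x) * F.f = c • (F.f * x * F.f)
    rw [mul_smul_comm, smul_mul_assoc])

lemma toCorner_val (x : Cl p q) : (F.toCorner x).1 = F.f * x * F.f := rfl

lemma f_mul_val (x : F.K) : F.f * x.1 = x.1 :=
  ((Subsemigroup.mem_corner_iff F.isIdempotentElem_f).1 x.2).1

lemma val_mul_f (x : F.K) : x.1 * F.f = x.1 :=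
  ((Subsemigroup.mem_corner_iff F.isIdempotentElem_f).1 x.2).2

lemma toCorner_self (x : F.K) : F.toCorner x.1 = x :=
  F.K_ext (by rw [toCorner_val, f_mul_val, val_mul_f])

lemma toCorner_one : F.toCorner 1 = 1 :=
  F.K_ext (by rw [toCorner_val, mul_one, F.isIdempotentElem_f.eq, val_one])

lemma toCorner_of_notMem {u : (Cl p q)ˣ} (hu : u ∈ monomialGroup p q)
    (h : u ∉ F.commutantGroup) : F.toCorner u = 0 :=
  F.K_ext (F.f_mul_mul_f_of_notMem hu h)

lemma toCorner_mul {u v : (Cl p q)ˣ} (hu : u ∈ F.commutantGroup) (hv : v ∈ F.commutantGroup) :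
    F.toCorner ((u * v : (Cl p q)ˣ) : Cl p q) = F.toCorner u * F.toCorner v := by
  apply F.K_ext
  rw [val_mul, toCorner_val, toCorner_val, toCorner_val, F.f_mul_mul_f_of_mem (mul_mem hu hv),
    F.f_mul_mul_f_of_mem hu, F.f_mul_mul_f_of_mem hv, mul_assoc, ← mul_assoc F.f,
    F.f_mul_mul_f_of_mem hv, Units.val_mul, mul_assoc]

lemma toCorner_of_mem_signedFactorGroup {u : (Cl p q)ˣ} (hu : u ∈ F.signedFactorGroup) :
    F.toCorner u = 1 ∨ F.toCorner u = -1 := by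
  rcases F.mul_f_of_mem_signedFactorGroup hu with h | h
  · exact Or.inl (F.K_ext (by
      rw [toCorner_val, F.f_mul_mul_f_of_mem (F.signedFactorGroup_le hu), h, val_one]))
  · exact Or.inr (F.K_ext (by
      rw [toCorner_val, F.f_mul_mul_f_of_mem (F.signedFactorGroup_le hu), h, val_neg, val_one]))

/-- A subspace of `K` that contains the images of all commuting monomials is everything. -/
lemma mem_of_forall_toCorner_mem {W : Submodule ℝ F.K}
    (h : ∀ u ∈ F.commutantGroup, F.toCorner u ∈ W) (x : F.K) : x ∈ W := by
  have h1 : (⊤ : Submodule ℝ (Cl p q)) ≤ W.comap F.toCorner := by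
    rw [← span_monomialGroup, Submodule.span_le]
    rintro _ ⟨u, hu, rfl⟩
    by_cases hu' : u ∈ F.commutantGroup
    · exact h u hu'
    · change F.toCorner u ∈ W
      rw [F.toCorner_of_notMem hu hu']
      exact W.zero_mem
  rw [← F.toCorner_self x]
  exact h1 trivial

/-! ### Coordinates in the spinor basis and the matrix of T_ε. -/

section Basis

variable {N : ℕ} {m : Fin N → Finset (Fin (p + q))}
  {b : Module.Basis (Fin N) (F.K)ᵐᵒᵖ F.S}

/-- Otherwise m_j f would be a right K-multiple of m_i f, against independence. -/
lemma inv_mul_notMem_commutantGroup (hb : ∀ i, (b i : Cl p q) = clMonomial p q (m i) * F.f)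
    {i j : Fin N} (hij : i ≠ j) :
    (clMonomial p q (m i))⁻¹ * clMonomial p q (m j) ∉ F.commutantGroup := by
  intro h
  have h1 : b j = MulOpposite.op
      (F.toCorner (((clMonomial p q (m i))⁻¹ * clMonomial p q (m j) : (Cl p q)ˣ) : Cl p q)) •
        b i := by
    refine Subtype.ext ?_
    change (b j : Cl p q) = (b i : Cl p q) * (F.toCorner _).1
    rw [hb, hb, toCorner_val, F.f_mul_mul_f_of_mem h, (F.commute_f h).eq, mul_assoc,
      ← mul_assoc F.f, F.isIdempotentElem_f.eq, ← (F.commute_f h).eq, ← mul_assoc,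
      ← Units.val_mul, mul_inv_cancel_left]
  have h2 := congrArg (fun x => b.repr x j) h1
  simp only [map_smul, Module.Basis.repr_self, Finsupp.smul_apply, Finsupp.single_eq_same,
    Finsupp.single_eq_of_ne (Ne.symm hij), smul_zero] at h2
  exact one_ne_zero h2

lemma f_mul_inv_mul_basis (hb : ∀ i, (b i : Cl p q) = clMonomial p q (m i) * F.f)
    (i j : Fin N) :
    F.f * ((clMonomial p q (m i))⁻¹ : (Cl p q)ˣ) * (b j : Cl p q) = if i = j then F.f else 0 := by
  rw [hb]
  split
  next h => subst h; rw [mul_assoc, Units.inv_mul_cancel_left, F.isIdempotentElem_f.eq]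
  next h =>
    rw [mul_assoc, ← mul_assoc _ _ F.f, ← Units.val_mul, ← mul_assoc]
    exact F.f_mul_mul_f_of_notMem (mul_mem (inv_mem (clMonomial_mem _)) (clMonomial_mem _))
      (F.inv_mul_notMem_commutantGroup hb h)

lemma basis_repr_val (hb : ∀ i, (b i : Cl p q) = clMonomial p q (m i) * F.f)
    (x : F.S) (i : Fin N) :
    (b.repr x i).unop.1 = F.f * ((clMonomial p q (m i))⁻¹ : (Cl p q)ˣ) * (x : Cl p q) := by
  have h : (x : Cl p q) = ∑ j, (b j : Cl p q) * (b.repr x j).unop.1 := by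
    conv_lhs => rw [← b.sum_repr x]
    rw [AddSubmonoidClass.coe_finsetSum]
    rfl
  rw [h, Finset.mul_sum, Finset.sum_congr rfl fun j _ => by
    rw [← mul_assoc, F.f_mul_inv_mul_basis hb]]
  simp [ite_mul, f_mul_val]

lemma spinorMatrix_apply (hb : ∀ i, (b i : Cl p q) = clMonomial p q (m i) * F.f)
    (u : Cl p q) (i j : Fin N) :
    F.spinorMatrix b u i j =
      F.toCorner (((clMonomial p q (m i))⁻¹ : (Cl p q)ˣ) * u * clMonomial p q (m j)) := by
  apply F.K_ext
  rw [toCorner_val]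
  change (b.repr (u • b j) i).unop.1 = _
  rw [F.basis_repr_val hb]
  change _ * (u * (b j : Cl p q)) = _
  rw [hb]
  simp only [mul_assoc]

/-- Otherwise all coordinates f m_i⁻¹ u f of u f vanish, although u is a unit and f ≠ 0. -/
lemma exists_inv_mul_mem_commutantGroup
    (hb : ∀ i, (b i : Cl p q) = clMonomial p q (m i) * F.f)
    {u : (Cl p q)ˣ} (hu : u ∈ monomialGroup p q) :
    ∃ i, (clMonomial p q (m i))⁻¹ * u ∈ F.commutantGroup := by
  by_contra! h
  let x : F.S := ⟨u * F.f, Ideal.mem_span_singleton'.2 ⟨u, rfl⟩⟩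
  have hx : b.repr x = 0 := by
    ext i
    apply MulOpposite.unop_injective
    apply F.K_ext
    rw [F.basis_repr_val hb]
    change F.f * _ * (u * F.f) = 0
    rw [mul_assoc, ← mul_assoc _ _ F.f, ← Units.val_mul, ← mul_assoc]
    exact F.f_mul_mul_f_of_notMem (mul_mem (inv_mem (clMonomial_mem _)) hu) (h i)
  have h1 : x = 0 := by simpa using hx
  have h2 : (u : Cl p q) * F.f = 0 := congrArg Subtype.val h1
  exact F.f_ne_zero ((Units.mul_right_eq_zero u).1 h2)

lemma card_commutantFinset (hb : ∀ i, (b i : Cl p q) = clMonomial p q (m i) * F.f) :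
    N * F.commutantFinset.card = 2 ^ (p + q + 1) := by
  rw [← card_signedMonomials (p := p) (q := q), ← Fintype.card_fin N, ← Finset.card_univ,
    ← Finset.card_product]
  refine Finset.card_nbij (fun x => clMonomial p q (m x.1) * x.2) ?_ ?_ ?_
  · rintro ⟨i, h⟩ hx
    rw [Finset.coe_product, Set.mem_prod, Finset.mem_coe, Finset.mem_coe, F.mem_commutantFinset] at hx
    exact mem_signedMonomials.2 (mul_mem (clMonomial_mem _) (F.commutantGroup_le hx.2))
  · rintro ⟨i, h⟩ hx ⟨i', h'⟩ hx' e
    simp only [Finset.coe_product, Set.mem_prod, Finset.mem_coe, F.mem_commutantFinset] at hx hx' e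
    have hi : i = i' := by
      by_contra hne
      refine F.inv_mul_notMem_commutantGroup hb hne ?_
      have : (clMonomial p q (m i))⁻¹ * clMonomial p q (m i') = h * h'⁻¹ := by
        rw [eq_mul_inv_iff_mul_eq, mul_assoc, ← e, inv_mul_cancel_left]
      rw [this]
      exact mul_mem hx.2 (inv_mem hx'.2)
    subst hi
    rw [mul_left_cancel e]
  · intro u hu
    obtain ⟨i, hi⟩ := F.exists_inv_mul_mem_commutantGroup hb (mem_signedMonomials.1 hu)
    refine ⟨(i, (clMonomial p q (m i))⁻¹ * u), ?_, mul_inv_cancel_left _ _⟩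
    rw [Finset.coe_product, Set.mem_prod, Finset.mem_coe, Finset.mem_coe, F.mem_commutantFinset]
    exact ⟨Finset.mem_univ _, hi⟩

/-- The assumptions on star concern only square roots of ±1, because the images of monomials in K
are such roots or zero; real linearity does the rest. -/
lemma spinorMatrix_TEps (hb : ∀ i, (b i : Cl p q) = clMonomial p q (m i) * F.f)
    {D : Type*} [Ring D] [StarRing D] [Algebra ℝ D]
    (h0 : ∀ (c : ℝ) (z : D), star (c • z) = c • star z)
    (h1 : ∀ z : D, z * z = 1 → star z = z) (h2 : ∀ z : D, z * z = -1 → star z = -z)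
    (φ : F.K ≃ₐ[ℝ] D) (u : Cl p q) :
    (F.spinorMatrix b (TEps p q u)).map φ = ((F.spinorMatrix b u).map φ)ᴴ := by
  have key (x : Cl p q) : φ (F.toCorner (TEps p q x)) = star (φ (F.toCorner x)) := by
    have hx : x ∈ Submodule.span ℝ
        ((fun u : (Cl p q)ˣ => (u : Cl p q)) '' monomialGroup p q) := by
      rw [span_monomialGroup]; trivial
    induction hx using Submodule.span_induction with
    | mem x hx =>
      obtain ⟨u, hu, rfl⟩ := hx
      rw [TEps_val hu]
      by_cases h : u ∈ F.commutantGroup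
      · have hsq : φ (F.toCorner u) * φ (F.toCorner u) =
            φ (F.toCorner ((u * u : (Cl p q)ˣ) : Cl p q)) := by
          rw [F.toCorner_mul h h, map_mul]
        rcases monomialGroup_mul_self hu with h3 | h3
        · rw [h3, Units.val_one, toCorner_one, map_one] at hsq
          rw [inv_eq_of_mul_eq_one_left h3]
          exact (h1 _ hsq).symm
        · rw [h3, Units.val_neg, Units.val_one, map_neg, toCorner_one, map_neg, map_one] at hsq
          rw [inv_eq_of_mul_eq_one_left (show -u * u = 1 by rw [neg_mul, h3, neg_neg]),
            Units.val_neg, map_neg, map_neg]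
          exact (h2 _ hsq).symm
      · rw [F.toCorner_of_notMem hu h, F.toCorner_of_notMem (inv_mem hu) (by rwa [inv_mem_iff])]
        simp
    | zero => simp
    | add x y _ _ hx hy => simp only [map_add, hx, hy, star_add]
    | smul c x _ hx => simp only [map_smul, hx, h0]
  ext i j
  rw [Matrix.conjTranspose_apply, Matrix.map_apply, Matrix.map_apply, F.spinorMatrix_apply hb,
    F.spinorMatrix_apply hb, ← key, TEps_mul, TEps_mul, TEps_inv (clMonomial_mem _),
    TEps_val (clMonomial_mem _), mul_assoc]

end Basis

end IdempotentFactors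

/-! ### Identification of K with ℝ, ℂ or ℍ. -/

lemma Quaternion.exists_algHom_of_anticommute {A : Type*} [Ring A] [Algebra ℝ A] {x y : A}
    (hx : x * x = -1) (hy : y * y = -1) (hxy : y * x = -(x * y)) :
    ∃ φ : ℍ[ℝ] →ₐ[ℝ] A, x ∈ φ.range ∧ y ∈ φ.range := by
  let B : QuaternionAlgebra.Basis A (-1 : ℝ) 0 (-1) :=
    { i := x
      j := y
      k := x * y
      i_mul_i := by rw [hx]; simp
      j_mul_j := by rw [hy]; simp
      i_mul_j := rfl
      j_mul_i := by rw [hxy]; simp }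
  exact ⟨B.liftHom,
    ⟨(⟨0, 1, 0, 0⟩ : ℍ[ℝ]), show B.lift _ = _ by simp [QuaternionAlgebra.Basis.lift, B]⟩,
    ⟨(⟨0, 0, 1, 0⟩ : ℍ[ℝ]), show B.lift _ = _ by simp [QuaternionAlgebra.Basis.lift, B]⟩⟩

namespace IdempotentFactors

variable {p q k : ℕ} (F : IdempotentFactors p q k)

lemma signedFactorFinset_subset : F.signedFactorFinset ⊆ F.commutantFinset := fun _ hv =>
  F.mem_commutantFinset.2 (F.signedFactorGroup_le (F.mem_signedFactorFinset.1 hv))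

/-- Injectivity is automatic from a division ring to a nontrivial ring; surjectivity holds since the
images of H span K. -/
lemma nonempty_algEquiv_of_range {D : Type*} [DivisionRing D] [Algebra ℝ D] (φ : D →ₐ[ℝ] F.K)
    (h : ∀ u ∈ F.commutantGroup, F.toCorner u ∈ φ.range) : Nonempty (F.K ≃ₐ[ℝ] D) :=
  ⟨(AlgEquiv.ofBijective φ ⟨φ.toRingHom.injective, fun x =>
    F.mem_of_forall_toCorner_mem (W := Subalgebra.toSubmodule φ.range) h x⟩).symm⟩

lemma toCorner_mem_of_mem_signedFactorGroup {R : Subalgebra ℝ F.K} {u : (Cl p q)ˣ}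
    (hu : u ∈ F.signedFactorGroup) : F.toCorner u ∈ R := by
  rcases F.toCorner_of_mem_signedFactorGroup hu with h | h <;> rw [h]
  · exact one_mem R
  · exact neg_mem (one_mem R)

lemma toCorner_mul_self {u : (Cl p q)ˣ} (hu : u ∈ F.commutantGroup) (h : u * u = -1) :
    F.toCorner u * F.toCorner u = -1 := by
  rw [← F.toCorner_mul hu hu, h, Units.val_neg, Units.val_one, map_neg, toCorner_one]

lemma toCorner_mem_of_mul_mem {R : Subalgebra ℝ F.K} {u v : (Cl p q)ˣ}
    (hu : u ∈ F.commutantGroup) (hv : v ∈ F.commutantGroup) (hv2 : v * v = -1)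
    (hvR : F.toCorner v ∈ R) (h : v * u ∈ F.signedFactorGroup) : F.toCorner u ∈ R := by
  have e : u = -(v * (v * u)) := by rw [← mul_assoc, hv2, neg_one_mul, neg_neg]
  rw [e, Units.val_neg, map_neg, F.toCorner_mul hv (mul_mem hv hu)]
  exact neg_mem (mul_mem hvR (F.toCorner_mem_of_mem_signedFactorGroup h))

lemma nonempty_algEquiv_real (hcard : F.commutantFinset.card = 2 ^ (k + 1)) :
    Nonempty (F.K ≃ₐ[ℝ] ℝ) := by
  refine F.nonempty_algEquiv_of_range (Algebra.ofId ℝ F.K) fun u hu => ?_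
  have h := Finset.eq_of_subset_of_card_le F.signedFactorFinset_subset
    (by rw [hcard, card_signedFactorFinset])
  rw [← F.mem_commutantFinset, ← h, F.mem_signedFactorFinset] at hu
  exact F.toCorner_mem_of_mem_signedFactorGroup hu

lemma exists_notMem_signedFactorGroup (hcard : 2 ^ (k + 1) < F.commutantFinset.card) :
    ∃ u ∈ F.commutantGroup, u ∉ F.signedFactorGroup := by
  rw [← F.card_signedFactorFinset] at hcard
  obtain ⟨u, hu, h⟩ := Finset.exists_mem_notMem_of_card_lt_card hcard
  exact ⟨u, F.mem_commutantFinset.1 hu, fun h' => h (F.mem_signedFactorFinset.2 h')⟩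

open Classical in
/-- The coset of `signedFactorGroup` by `u⁻¹`, together with the group itself. -/
noncomputable def twoCosets (u : (Cl p q)ˣ) : Finset (Cl p q)ˣ :=
  F.signedFactorFinset ∪ F.signedFactorFinset.image (u⁻¹ * ·)

lemma mem_twoCosets {u v : (Cl p q)ˣ} :
    v ∈ F.twoCosets u ↔ v ∈ F.signedFactorGroup ∨ u * v ∈ F.signedFactorGroup := by
  classical
  rw [twoCosets, Finset.mem_union, F.mem_signedFactorFinset, Finset.mem_image]
  refine or_congr Iff.rfl ⟨?_, fun h => ⟨u * v, F.mem_signedFactorFinset.2 h,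
    inv_mul_cancel_left u v⟩⟩
  rintro ⟨w, hw, rfl⟩
  rwa [mul_inv_cancel_left, ← F.mem_signedFactorFinset]

lemma card_twoCosets {u : (Cl p q)ˣ} (h : u ∉ F.signedFactorGroup) :
    (F.twoCosets u).card = 2 ^ (k + 2) := by
  classical
  rw [twoCosets, Finset.card_union_of_disjoint,
    Finset.card_image_of_injective _ (mul_right_injective _), card_signedFactorFinset]
  · ring
  · rw [Finset.disjoint_left]
    intro v hv hv'
    obtain ⟨w, hw, rfl⟩ := Finset.mem_image.1 hv'
    rw [F.mem_signedFactorFinset] at hv hw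
    have := mul_mem hw (inv_mem hv)
    rw [mul_inv_rev, mul_inv_cancel_left, inv_inv] at this
    exact h this

lemma twoCosets_subset {u : (Cl p q)ˣ} (hu : u ∈ F.commutantGroup) :
    F.twoCosets u ⊆ F.commutantFinset := by
  intro v hv
  rw [F.mem_commutantFinset]
  rcases F.mem_twoCosets.1 hv with h | h
  · exact F.signedFactorGroup_le h
  · simpa using mul_mem (inv_mem hu) (F.signedFactorGroup_le h)

lemma nonempty_algEquiv_complex (hcard : F.commutantFinset.card = 2 ^ (k + 2))
    (hsq : ∀ u ∈ F.commutantGroup, u ∉ F.signedFactorGroup → u * u = -1) :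
    Nonempty (F.K ≃ₐ[ℝ] ℂ) := by
  obtain ⟨a, ha, ha'⟩ := F.exists_notMem_signedFactorGroup (by
    rw [hcard]; exact Nat.pow_lt_pow_right one_lt_two (by omega))
  have ha2 := hsq a ha ha'
  refine F.nonempty_algEquiv_of_range
    (Complex.lift ⟨F.toCorner a, F.toCorner_mul_self ha ha2⟩) fun u hu => ?_
  have h := Finset.eq_of_subset_of_card_le (F.twoCosets_subset ha)
    (by rw [hcard, F.card_twoCosets ha'])
  rw [← F.mem_commutantFinset, ← h, F.mem_twoCosets] at hu
  rcases hu with hu | hu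
  · exact F.toCorner_mem_of_mem_signedFactorGroup hu
  · have hu' : u ∈ F.commutantGroup := by
      simpa using mul_mem (inv_mem ha) (F.signedFactorGroup_le hu)
    exact F.toCorner_mem_of_mul_mem hu' ha ha2 ⟨Complex.I, by simp⟩ hu

lemma mul_eq_neg_mul_of_mul_self {A : Type*} [Ring A] {x y : Aˣ} (hx : x * x = -1)
    (hy : y * y = -1) (hxy : x * y * (x * y) = -1) : x * y = -(y * x) := by
  have e : y * x * (x * y) = 1 := by
    rw [mul_assoc, ← mul_assoc x, hx, neg_one_mul, mul_neg, hy, neg_neg]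
  have e2 : x * y * (x * y) = -(y * x) * (x * y) := by rw [hxy, neg_mul, e]
  exact mul_right_cancel e2

/-- The order of H only supplies a outside E and b outside E ∪ a⁻¹E; these anticommute and give a
copy of ℍ in K. That it is all of K follows from the square condition. -/
lemma nonempty_algEquiv_quaternion (hcard : F.commutantFinset.card = 2 ^ (k + 3))
    (hsq : ∀ u ∈ F.commutantGroup, u ∉ F.signedFactorGroup → u * u = -1) :
    Nonempty (F.K ≃ₐ[ℝ] ℍ[ℝ]) := by
  obtain ⟨a, ha, ha'⟩ := F.exists_notMem_signedFactorGroup (by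
    rw [hcard]; exact Nat.pow_lt_pow_right one_lt_two (by omega))
  have ha2 := hsq a ha ha'
  have hlt : (F.twoCosets a).card < F.commutantFinset.card := by
    rw [hcard, F.card_twoCosets ha']; exact Nat.pow_lt_pow_right one_lt_two (by omega)
  obtain ⟨b, hb, hb'⟩ := Finset.exists_mem_notMem_of_card_lt_card hlt
  rw [F.mem_twoCosets, not_or] at hb'
  rw [F.mem_commutantFinset] at hb
  have hb2 := hsq b hb hb'.1
  have hab2 := hsq (a * b) (mul_mem ha hb) hb'.2
  have hab := mul_eq_neg_mul_of_mul_self ha2 hb2 hab2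
  have hba' : F.toCorner b * F.toCorner a = -(F.toCorner a * F.toCorner b) := by
    rw [← F.toCorner_mul ha hb, ← F.toCorner_mul hb ha, hab, Units.val_neg, map_neg, neg_neg]
  obtain ⟨φ, hA, hB⟩ := Quaternion.exists_algHom_of_anticommute (F.toCorner_mul_self ha ha2)
    (F.toCorner_mul_self hb hb2) hba'
  refine F.nonempty_algEquiv_of_range φ fun u hu => ?_
  -- Such a u would anticommute with a, b and ab. But anticommuting with both a and b means
  -- commuting with ab.
  by_contra hR
  have h1 : u ∉ F.signedFactorGroup := fun h =>
    hR (F.toCorner_mem_of_mem_signedFactorGroup h)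
  have h2 : a * u ∉ F.signedFactorGroup := fun h =>
    hR (F.toCorner_mem_of_mul_mem hu ha ha2 hA h)
  have h3 : b * u ∉ F.signedFactorGroup := fun h =>
    hR (F.toCorner_mem_of_mul_mem hu hb hb2 hB h)
  have h4 : a * b * u ∉ F.signedFactorGroup := fun h =>
    hR (F.toCorner_mem_of_mul_mem hu (mul_mem ha hb) hab2
      (by rw [F.toCorner_mul ha hb]; exact mul_mem hA hB) h)
  have hu2 := hsq u hu h1
  have hau := mul_eq_neg_mul_of_mul_self ha2 hu2 (hsq _ (mul_mem ha hu) h2)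
  have hbu := mul_eq_neg_mul_of_mul_self hb2 hu2 (hsq _ (mul_mem hb hu) h3)
  have habu := mul_eq_neg_mul_of_mul_self hab2 hu2 (hsq _ (mul_mem (mul_mem ha hb) hu) h4)
  have hcomm : a * b * u = u * (a * b) := by
    rw [mul_assoc, hbu, mul_neg, ← mul_assoc, hau, neg_mul, neg_neg, mul_assoc]
  rw [hcomm] at habu
  have h5 : (1 : (Cl p q)ˣ) = -1 := by
    have h := congrArg (· * (u * (a * b))⁻¹) habu
    simp only [neg_mul] at h
    rwa [mul_inv_cancel] at h
  exact neg_one_ne_one_units h5.symm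

end IdempotentFactors

/-! ### Conjugation of square roots of ±1, and the theorem. -/

lemma Quaternion.star_eq_self_of_mul_self_eq_one {z : ℍ[ℝ]} (h : z * z = 1) : star z = z := by
  rcases mul_self_eq_one_iff.1 h with rfl | rfl <;> simp

/-- Such a z has norm 1, so both its conjugate and -z are its inverse. -/
lemma Quaternion.star_eq_neg_of_mul_self_eq_neg_one {z : ℍ[ℝ]} (h : z * z = -1) :
    star z = -z := by
  have h0 : z ≠ 0 := by rintro rfl; simp at h
  have h1 := congrArg Quaternion.normSq h
  rw [map_mul, Quaternion.normSq_neg, map_one] at h1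
  have h2 : Quaternion.normSq z = 1 := by
    have := Quaternion.normSq_nonneg (a := z)
    nlinarith
  apply mul_left_cancel₀ h0
  rw [Quaternion.self_mul_star, h2, mul_neg, h, neg_neg]
  simp

lemma Complex.star_eq_self_of_mul_self_eq_one {z : ℂ} (h : z * z = 1) : star z = z := by
  rcases mul_self_eq_one_iff.1 h with rfl | rfl <;> simp

lemma Complex.star_eq_neg_of_mul_self_eq_neg_one {z : ℂ} (h : z * z = -1) : star z = -z := by
  have h1 : (z - Complex.I) * (z + Complex.I) = 0 := by
    linear_combination h - Complex.I_mul_I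
  rcases mul_eq_zero.1 h1 with h | h
  · rw [sub_eq_zero.1 h]; simp
  · rw [eq_neg_of_add_eq_zero_left h]; simp

theorem mainTheorem4 (p q k : ℕ) (hpq : p + q ≤ 9) (hsimple : ((p : ℤ) - q) % 4 ≠ 1)
    (hk : (k : ℤ) = q - radonHurwitz (q - p))
    (F : IdempotentFactors p q k)
    (m : Fin (2 ^ k) → Finset (Fin (p + q))) (hm : m 0 = ∅)
    (b : Module.Basis (Fin (2 ^ k)) (F.K)ᵐᵒᵖ F.S)
    (hb : ∀ i, (b i : Cl p q) = clMonomial p q (m i) * F.f)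
    (l : Fin (2 ^ k)) (ψ : Cl p q) (hψ : ψ ∈ Ideal.span {F.conj (m l)}) :
    ((((p : ℤ) - q) % 8 = 0 ∨ ((p : ℤ) - q) % 8 = 1 ∨ ((p : ℤ) - q) % 8 = 2) →
      Nonempty (F.K ≃ₐ[ℝ] ℝ) ∧
        F.spinorMatrix b (TEps p q ψ) = (F.spinorMatrix b ψ)ᵀ) ∧
    ((((p : ℤ) - q) % 8 = 3 ∨ ((p : ℤ) - q) % 8 = 7) →
      Nonempty (F.K ≃ₐ[ℝ] ℂ) ∧
        ∀ φ : F.K ≃ₐ[ℝ] ℂ,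
          (F.spinorMatrix b (TEps p q ψ)).map φ = ((F.spinorMatrix b ψ).map φ)ᴴ) ∧
    ((((p : ℤ) - q) % 8 = 4 ∨ ((p : ℤ) - q) % 8 = 5 ∨ ((p : ℤ) - q) % 8 = 6) →
      Nonempty (F.K ≃ₐ[ℝ] ℍ[ℝ]) ∧
        ∀ φ : F.K ≃ₐ[ℝ] ℍ[ℝ],
          (F.spinorMatrix b (TEps p q ψ)).map φ = ((F.spinorMatrix b ψ).map φ)ᴴ) := by
  obtain ⟨hR, hC, hH⟩ := signatureGauss_eq p q k hpq hsimple hk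
  have hcard (d : ℕ) (hd : p + q = 2 * k + d) : F.commutantFinset.card = 2 ^ (k + d + 1) := by
    have h := F.card_commutantFinset hb
    have e : p + q + 1 = k + (k + d + 1) := by omega
    have e' : (2 : ℕ) ^ (p + q + 1) = 2 ^ k * 2 ^ (k + d + 1) := by rw [← pow_add, ← e]
    rw [e'] at h
    exact Nat.eq_of_mul_eq_mul_left (by positivity) h
  refine ⟨fun h => ?_, fun h => ?_, fun h => ?_⟩
  · obtain ⟨φ⟩ := F.nonempty_algEquiv_real (hcard 0 (hR h).1)
    refine ⟨⟨φ⟩, ?_⟩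
    have := F.spinorMatrix_TEps hb (fun c z => by simp) (fun z _ => star_trivial z)
      -- Vacuous: -1 has no real square root.
      (fun z hz => by nlinarith [mul_self_nonneg z]) φ ψ
    ext i j : 2
    have h1 := congrFun (congrFun this i) j
    rw [Matrix.conjTranspose_apply, Matrix.map_apply, Matrix.map_apply, star_trivial] at h1
    exact φ.injective h1
  · obtain ⟨h1, h2⟩ := hC h
    refine ⟨F.nonempty_algEquiv_complex (hcard 1 h1) fun u hu hu' =>
      F.mul_self_eq_neg_one ?_ hu hu', fun φ => F.spinorMatrix_TEps hb (fun c z => by simp)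
        (fun _ => Complex.star_eq_self_of_mul_self_eq_one)
        (fun _ => Complex.star_eq_neg_of_mul_self_eq_neg_one) φ ψ⟩
    -- The extremal condition reads 0 = 2·2^(k+1) - 2^(k+2).
    rw [h2, hcard 1 h1]
    push_cast
    ring
  · obtain ⟨h1, h2⟩ := hH h
    refine ⟨F.nonempty_algEquiv_quaternion (hcard 2 h1) fun u hu hu' =>
      F.mul_self_eq_neg_one ?_ hu hu', fun φ => F.spinorMatrix_TEps hb (fun c z => by simp)
        (fun _ => Quaternion.star_eq_self_of_mul_self_eq_one)
        (fun _ => Quaternion.star_eq_neg_of_mul_self_eq_neg_one) φ ψ⟩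
    -- Here it reads -2·2^(k+1) = 2·2^(k+1) - 2^(k+3).
    rw [h2, hcard 2 h1]
    push_cast
    ring
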